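/- Let $n\ge 2$ and $0\le \ell\le n/2$. Write $(z,w)\in\mathbb C^n\times\mathbb C$, $w=u+iv$, $|z|_\ell^2=-\sum_{j\le\ell}|z_j|^2+\sum_{j>\ell}|z_j|^2$ and $\Delta_\ell=-\sum_{j\le\ell}\frac{\partial^2}{\partial z_j\partial\bar z_j}+\sum_{j>\ell}\frac{\partial^2}{\partial z_j\partial\bar z_j}$. Let $M\subset\mathbb C^n\times\mathbb C$ be a smooth ($C^\infty$) real hypersurface and $p\in M$. An *appropriate contact form* at $p$ is a real non-zero linear form $\theta_p$ on $T_pM$ that annihilates $T^{(1,0)}_pM\oplus T^{(0,1)}_pM$ and whose Levi form $L_{\theta_p}(X,Y)=-i\langle d\theta|_p, X\wedge\overline Y\rangle$, $X,Y\in T^{(1,0)}_pM$, has $\ell$ negative and $n-\ell$ positive eigenvalues; here $\theta$ is any smooth 1-form near $p$ that extends $\theta_p$ and annihilates $T^{(1,0)}_qM\oplus T^{(0,1)}_qM$ for all $q\in M$ near $p$. $M$ is *Levi non-degenerate of signature $\ell$* if an appropriate contact form exists at each of its points. **Proposition.** Let $M$ be Levi non-degenerate of signature $\ell$, let $p\in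 M$, and let $\theta_p$ be an appropriate contact form at $p$. Then there is a biholomorphic map $F$ from a neighborhood of $p$ onto a neighborhood of $0$ with $F(p)=0$ such that $F(M)$ is defined near $0$ by $$r=v-|z|_\ell^2+\tfrac14 s(z,\bar z)+R(z,\bar z,u)=0,\qquad s(z,\bar z)=\sum_{\alpha,\beta,\gamma,\delta=1}^n s_{\alpha\bar\beta\gamma\bar\delta}\,z_\alpha\bar z_\beta z_\gamma\bar z_\delta ,$$ where 1. $s_{\alpha\bar\beta\gamma\bar\delta}=s_{\gamma\bar\beta\alpha\bar\delta}=s_{\gamma\bar\delta\alpha\bar\beta}$ and $\overline{s_{\alpha\bar\beta\gamma\bar\delta}}=s_{\beta\bar\alpha\delta\bar\gamma}$; 2. $s$ is trace-free: $\sum_{\alpha,\beta}s_{\alpha\bar\beta\gamma\bar\delta}\,g_0^{\bar\beta\alpha}=0$ for all $\gamma,\delta$, where $g_0^{\bar\beta\alpha}=0$ for $\beta\ne\alpha$, $g_0^{\bar\beta\beta}=-1$ for $\beta\le\ell$ and $g_0^{\bar\beta\beta}=1$ for $\beta>\ell$; equivalently $\Delta_\ell s\equiv 0$; 3. $R$ is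 real-valued and smooth near $0$, $R=o(|(z,u)|^4)$ as $(z,u)\to0$, and $R=o_{wt}(4)$, that is, $R(tz,t\bar z,t^2u)/t^4\to0$ as $t\to0$ in $\mathbb R\setminus\{0\}$, uniformly for $(z,u)$ in compact sets; 4. $i\partial r|_0=(F^{-1})^*\theta_p$ as forms on $T_0F(M)$. -/

import Mathlib

open scoped ContDiff Topology ComplexConjugate

noncomputable section

namespace CRHyp

/-- The space `ℂⁿ × ℂ` with coordinates `(z, w)`. -/
abbrev Cn1 (n : ℕ) : Type := (Fin n → ℂ) × ℂ

/-! ### Real hypersurfaces, tangent spaces, contact forms and the Levi form -/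

/-- `ρ` is a smooth local defining function of `M` near the point `q ∈ M`. -/
def IsLocalDefining {n : ℕ} (M : Set (Cn1 n)) (q : Cn1 n) (ρ : Cn1 n → ℝ) : Prop :=
  ∃ U : Set (Cn1 n), IsOpen U ∧ q ∈ U ∧ ContDiffOn ℝ ∞ ρ U ∧ fderiv ℝ ρ q ≠ 0 ∧
    ∀ x ∈ U, x ∈ M ↔ ρ x = 0

/-- `M` is a smooth (embedded) real hypersurface of `ℂⁿ × ℂ`. -/
def IsSmoothHypersurface {n : ℕ} (M : Set (Cn1 n)) : Prop :=
  ∀ q ∈ M, ∃ ρ : Cn1 n → ℝ, IsLocalDefining M q ρ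

/-- The real tangent space `T_q M`: the common kernel of the differentials at `q` of the local
defining functions of `M` near `q`. (For a hypersurface all these kernels coincide.) -/
def tangentSpaceAt {n : ℕ} (M : Set (Cn1 n)) (q : Cn1 n) : Submodule ℝ (Cn1 n) :=
  ⨅ (ρ : Cn1 n → ℝ) (_ : IsLocalDefining M q ρ), (fderiv ℝ ρ q).toLinearMap.ker

/-- The complex tangent space `T_q M ∩ i T_q M`. A vector `a` of it stands for the vector
`X_a = ∑ a_j ∂/∂z_j = (a - i J a) / 2` of type `(1,0)`, which identifies it with
`T_q^{(1,0)} M`. -/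
def complexTangentSpaceAt {n : ℕ} (M : Set (Cn1 n)) (q : Cn1 n) : Submodule ℂ (Cn1 n) where
  carrier := {x | x ∈ tangentSpaceAt M q ∧ Complex.I • x ∈ tangentSpaceAt M q}
  add_mem' := by
    rintro x y ⟨hx, hx'⟩ ⟨hy, hy'⟩
    refine ⟨add_mem hx hy, ?_⟩
    rw [smul_add]
    exact add_mem hx' hy'
  zero_mem' := ⟨zero_mem _, by rw [smul_zero]; exact zero_mem _⟩
  smul_mem' := by
    rintro c x ⟨hx, hx'⟩
    have key : ∀ c : ℂ, c • x = c.re • x + c.im • (Complex.I • x) := by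
      intro c
      rw [← Complex.coe_smul c.re, ← Complex.coe_smul c.im, smul_smul, ← add_smul,
        Complex.re_add_im]
    refine ⟨?_, ?_⟩
    · rw [key]
      exact add_mem (Submodule.smul_mem _ _ hx) (Submodule.smul_mem _ _ hx')
    · rw [smul_smul, key]
      exact add_mem (Submodule.smul_mem _ _ hx) (Submodule.smul_mem _ _ hx')

/-- `L_θ(X_a, X_b) = -i ⟨dθ|_p, X_a ∧ conj X_b⟩`, with the real 2-form `dθ|_p` extended
complex bilinearly and `X_a = (a - i J a) / 2`, `conj X_b = (b + i J b) / 2`. -/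
def leviForm {n : ℕ} (θ : Cn1 n → Cn1 n [⋀^Fin 1]→L[ℝ] ℝ) (p : Cn1 n) (a b : Cn1 n) : ℂ :=
  -Complex.I * (1 / 4) *
    ((extDeriv θ p ![a, b] : ℂ) + (extDeriv θ p ![Complex.I • a, Complex.I • b] : ℂ)
      + Complex.I * ((extDeriv θ p ![a, Complex.I • b] : ℂ)
        - (extDeriv θ p ![Complex.I • a, b] : ℂ)))

/-- The matrix of the Levi form in a family of vectors of type `(1,0)`. -/
def leviMatrix {n : ℕ} (θ : Cn1 n → Cn1 n [⋀^Fin 1]→L[ℝ] ℝ) (p : Cn1 n)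
    (b : Fin n → Cn1 n) : Matrix (Fin n) (Fin n) ℂ :=
  Matrix.of fun i j => leviForm θ p (b i) (b j)

theorem leviForm_conj {n : ℕ} (θ : Cn1 n → Cn1 n [⋀^Fin 1]→L[ℝ] ℝ) (p : Cn1 n) (a b : Cn1 n) :
    conj (leviForm θ p b a) = leviForm θ p a b := by
  have h : ∀ x y : Cn1 n, extDeriv θ p ![x, y] = -extDeriv θ p ![y, x] := by
    intro x y
    have h1 := (extDeriv θ p).toAlternatingMap.map_swap ![y, x] (i := 0) (j := 1) (by simp)
    have h2 : (![y, x] : Fin 2 → Cn1 n) ∘ Equiv.swap 0 1 = ![x, y] := by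
      ext i : 1
      fin_cases i <;> simp
    rw [h2] at h1
    exact h1
  simp only [leviForm, map_mul, map_add, map_sub, map_neg, Complex.conj_I, Complex.conj_ofReal,
    map_div₀, map_one, map_ofNat]
  rw [h b a, h (Complex.I • b) (Complex.I • a), h b (Complex.I • a), h (Complex.I • b) a]
  push_cast
  ring

theorem leviMatrix_isHermitian {n : ℕ} (θ : Cn1 n → Cn1 n [⋀^Fin 1]→L[ℝ] ℝ) (p : Cn1 n)
    (b : Fin n → Cn1 n) : (leviMatrix θ p b).IsHermitian := by
  ext i j
  exact leviForm_conj θ p (b i) (b j)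

/-- `Θ` is a smooth 1-form near `p` extending `θ` that annihilates the complex tangent space
of `M` at all points of `M` near `p`. -/
def IsContactExtension {n : ℕ} (M : Set (Cn1 n)) (p : Cn1 n) (θ : tangentSpaceAt M p →ₗ[ℝ] ℝ)
    (Θ : Cn1 n → Cn1 n [⋀^Fin 1]→L[ℝ] ℝ) : Prop :=
  (∃ U : Set (Cn1 n), IsOpen U ∧ p ∈ U ∧ ContDiffOn ℝ ∞ Θ U ∧
    ∀ q ∈ M ∩ U, ∀ x ∈ complexTangentSpaceAt M q, Θ q ![x] = 0) ∧
  ∀ x : tangentSpaceAt M p, Θ p ![(x : Cn1 n)] = θ x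

/-- `θ ∈ E_p`: the real covector `θ ≠ 0` on `T_p M` annihilates the complex tangent space, and
the Levi form associated with it, computed with an extension of `θ`, has `ℓ` negative and
`n - ℓ` positive eigenvalues. -/
def IsAppropriateContactForm {n : ℕ} (M : Set (Cn1 n)) (ℓ : ℕ) (p : Cn1 n)
    (θ : tangentSpaceAt M p →ₗ[ℝ] ℝ) : Prop :=
  θ ≠ 0 ∧
  (∀ x : tangentSpaceAt M p, (x : Cn1 n) ∈ complexTangentSpaceAt M p → θ x = 0) ∧
  ∃ Θ : Cn1 n → Cn1 n [⋀^Fin 1]→L[ℝ] ℝ, IsContactExtension M p θ Θ ∧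
    ∃ b : Module.Basis (Fin n) ℂ (complexTangentSpaceAt M p),
      let h := leviMatrix_isHermitian Θ p (fun i => (b i : Cn1 n))
      (Finset.univ.filter fun i => h.eigenvalues i < 0).card = ℓ ∧
      (Finset.univ.filter fun i => 0 < h.eigenvalues i).card = n - ℓ

/-- `M` is Levi non-degenerate of signature `ℓ` at each of its points: for some contact form at
the point, the Levi form has `ℓ` negative and `n - ℓ` positive eigenvalues. -/
def IsLeviNondegenerate {n : ℕ} (M : Set (Cn1 n)) (ℓ : ℕ) : Prop :=
  ∀ q ∈ M, ∃ θ : tangentSpaceAt M q →ₗ[ℝ] ℝ, IsAppropriateContactForm M ℓ q θ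

/-! ### Wirtinger derivatives -/

/-- `(∂f)_x (v)`, the value at `v` of the `(1,0)`-part of the differential of `f`. -/
def del {V : Type*} [NormedAddCommGroup V] [NormedSpace ℝ V] [Module ℂ V]
    (f : V → ℂ) (x v : V) : ℂ :=
  (1 / 2) * (fderiv ℝ f x v - Complex.I * fderiv ℝ f x (Complex.I • v))

/-- `(∂̄f)_x (v)`, the value at `v` of the `(0,1)`-part of the differential of `f`. -/
def delBar {V : Type*} [NormedAddCommGroup V] [NormedSpace ℝ V] [Module ℂ V]
    (f : V → ℂ) (x v : V) : ℂ :=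
  (1 / 2) * (fderiv ℝ f x v + Complex.I * fderiv ℝ f x (Complex.I • v))

/-! ### The normal form -/

/-- The sign `-1` for the first `ℓ` indices and `1` for the others. -/
def sgn {n : ℕ} (ℓ : ℕ) (j : Fin n) : ℂ := if (j : ℕ) < ℓ then -1 else 1

/-- `|z|_ℓ² = -∑_{j ≤ ℓ} |z_j|² + ∑_{j > ℓ} |z_j|²`. -/
def normSqL {n : ℕ} (ℓ : ℕ) (z : Fin n → ℂ) : ℂ := ∑ j, sgn ℓ j * (z j * conj (z j))

/-- `Δ_ℓ f = -∑_{j ≤ ℓ} ∂²f/∂z_j∂z̄_j + ∑_{j > ℓ} ∂²f/∂z_j∂z̄_j`. -/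
def laplacianL {n : ℕ} (ℓ : ℕ) (f : (Fin n → ℂ) → ℂ) (z : Fin n → ℂ) : ℂ :=
  ∑ j, sgn ℓ j * del (fun ζ => delBar f ζ (Pi.single j 1)) z (Pi.single j 1)

/-- `s(z, z̄) = ∑ s_{αβ̄γδ̄} z_α z̄_β z_γ z̄_δ`. -/
def quartic {n : ℕ} (s : Fin n → Fin n → Fin n → Fin n → ℂ) (z : Fin n → ℂ) : ℂ :=
  ∑ α, ∑ β, ∑ γ, ∑ δ, s α β γ δ * (z α * conj (z β) * z γ * conj (z δ))

/-- The inverse matrix `g₀^{β̄α}` of the model Levi form. -/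
def gInv {n : ℕ} (ℓ : ℕ) (β α : Fin n) : ℂ := if β = α then sgn ℓ β else 0

/-- The symmetries and the trace condition of the coefficients `s_{αβ̄γδ̄}`. -/
structure IsChernMoserTensor {n : ℕ} (ℓ : ℕ) (s : Fin n → Fin n → Fin n → Fin n → ℂ) :
    Prop where
  symm_left : ∀ α β γ δ, s α β γ δ = s γ β α δ
  symm_pair : ∀ α β γ δ, s γ β α δ = s γ δ α β
  conj_eq : ∀ α β γ δ, conj (s α β γ δ) = s β α δ γ
  trace_free : ∀ γ δ, ∑ α, ∑ β, s α β γ δ * gInv ℓ β α = 0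

/-- `h = o_wt(k)`: `h(tz, t²u) / t^k → 0` as `t → 0`, uniformly for `(z, u)` in compact sets. -/
def IsLittleOWt {n : ℕ} (k : ℕ) (h : (Fin n → ℂ) × ℝ → ℝ) : Prop :=
  ∀ K : Set ((Fin n → ℂ) × ℝ), IsCompact K →
    TendstoUniformlyOn (fun (t : ℝ) (y : (Fin n → ℂ) × ℝ) => h (t • y.1, t ^ 2 * y.2) / t ^ k)
      (fun _ => 0) (𝓝[≠] 0) K

/-- `r = v - |z|_ℓ² + (1/4) s(z, z̄) + R(z, z̄, u)`, where `w = u + iv`. -/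
def normalForm {n : ℕ} (ℓ : ℕ) (s : Fin n → Fin n → Fin n → Fin n → ℂ)
    (R : (Fin n → ℂ) × ℝ → ℝ) (x : Cn1 n) : ℂ :=
  (x.2.im : ℂ) - normSqL ℓ x.1 + (1 / 4) * quartic s x.1 + (R (x.1, x.2.re) : ℂ)

end CRHyp

end

open CRHyp

noncomputable section

namespace CRHyp

open Filter Asymptotics
open scoped Pointwise

/-! ### Homogeneous functions and Taylor expansions -/

section Homogeneous

variable {E F : Type*} [NormedAddCommGroup E] [NormedSpace ℝ E] [NormedAddCommGroup F]
  [NormedSpace ℝ F]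

/-! Let `ρ` define `M` near `p`, and let `e` satisfy `dρ(e) = 1`, `dρ(ie) = 0`. A form annihilating
the complex tangent spaces is determined on `M` by `ρ` and its values on `e` and `ie`, so its Levi
form is the complex Hessian of `ρ` up to the factor `Θ(ie)` (`fderiv_contact`, `leviForm_self`).
Sylvester's law then yields a complex linear frame `T` in which the Levi form is `|z|_ℓ²` and `θ` is
`du/2` (`exists_adapted_frame`). The factor `1/2` is what condition 4 requires, since `i∂v = dw/2`.

In these coordinates `M` is a graph `v = φ(z, u)`. It is improved by holomorphic maps `(z, w) ↦ (z +
f, w + g)` tangent to the identity, so the normalization of `θ` is never disturbed. If `φ = |z|_ℓ² +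
P + O(d + 1)` with `P` homogeneous of degree `d`, then to leading order such a map adds `2 Re⟨f, z⟩
- Im g` to `P`; this is made precise, with all error terms, in `IsGraphChart.normalize`. Up to
degree 4 every real homogeneous polynomial in `(z, z̄, u)` is `Im g + Re ∑ f_j z̄_j` plus a form of
type `(2, 2)` in `(z, z̄)` (`hasSplitting_diag`).

In degree 2 the Hermitian part is already `|z|_ℓ²` and `g` removes the rest. In degree 3 everything
can be removed. In degree 4 a `(2, 2)` form remains, and it splits into a trace-free part and a
multiple of `|z|_ℓ²` (`exists_trace_decomposition`). The multiple, `2|z|_ℓ² H`, is cancelled by the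
shift `z ↦ z + wBz` with `⟨Bz, z⟩ = iH`, because `Re(i w · iH)` is replaced here by `Re⟨wBz, z⟩ =
-vH` and `v` is `|z|_ℓ²` to leading order (`IsGraphChart.step_four`).

All orders are counted in the ordinary degree of `(z, u)`. The remainder is `O(|(z, u)|⁵)`, which
gives both smallness conditions on `R`. -/

theorem eq_zero_of_homogeneous_of_isBigO {T : E → F} {k : ℕ}
    (hT : ∀ (t : ℝ) (y : E), T (t • y) = t ^ k • T y)
    (hO : T =O[𝓝 0] fun y => ‖y‖ ^ (k + 1)) (y : E) : T y = 0 := by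
  obtain ⟨C, hC⟩ := hO.bound
  have hlim : Tendsto (fun t : ℝ => t • y) (𝓝[>] 0) (𝓝 0) := by
    have : Tendsto (fun t : ℝ => t • y) (𝓝 0) (𝓝 ((0 : ℝ) • y)) :=
      (continuous_id.smul continuous_const).tendsto 0
    rw [zero_smul] at this
    exact this.mono_left nhdsWithin_le_nhds
  have h1 : ∀ᶠ t : ℝ in 𝓝[>] 0, ‖T y‖ ≤ t * (C * ‖y‖ ^ (k + 1)) := by
    filter_upwards [hlim.eventually hC, self_mem_nhdsWithin] with t ht htpos
    have htpos : 0 < t := htpos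
    rw [hT, norm_smul, norm_pow, norm_pow, norm_norm, norm_smul, Real.norm_of_nonneg htpos.le,
      mul_pow, pow_succ t] at ht
    have h2 : t ^ k * ‖T y‖ ≤ t ^ k * (t * (C * ‖y‖ ^ (k + 1))) := by
      refine ht.trans (le_of_eq (by ring))
    exact le_of_mul_le_mul_left h2 (pow_pos htpos k)
  have h2 : Tendsto (fun t : ℝ => t * (C * ‖y‖ ^ (k + 1))) (𝓝[>] 0) (𝓝 0) := by
    have : Tendsto (fun t : ℝ => t * (C * ‖y‖ ^ (k + 1))) (𝓝 0)
        (𝓝 (0 * (C * ‖y‖ ^ (k + 1)))) := (continuous_id.mul continuous_const).tendsto 0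
    rw [zero_mul] at this
    exact this.mono_left nhdsWithin_le_nhds
  exact norm_le_zero_iff.1 (ge_of_tendsto h2 h1)

theorem isBigO_pow_of_le {E : Type*} [NormedAddCommGroup E] {k m : ℕ} (h : k ≤ m) :
    (fun y : E => ‖y‖ ^ m) =O[𝓝 0] fun y => ‖y‖ ^ k := by
  refine IsBigO.of_bound 1 ?_
  filter_upwards [Metric.ball_mem_nhds (0 : E) one_pos] with y hy
  rw [mem_ball_zero_iff] at hy
  rw [one_mul, norm_pow, norm_pow, norm_norm]
  exact pow_le_pow_of_le_one (norm_nonneg _) hy.le h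

theorem multilinear_diag_isBigO {k : ℕ} (m : ContinuousMultilinearMap ℝ (fun _ : Fin k => E) F) :
    (fun y => m fun _ => y) =O[𝓝 0] fun y : E => ‖y‖ ^ k := by
  refine IsBigO.of_bound ‖m‖ (Eventually.of_forall fun y => ?_)
  rw [norm_pow, norm_norm]
  simpa using m.le_opNorm (fun _ => y)

variable [CompleteSpace F]

theorem taylor_isBigO {f : E → F} {d : ℕ} (hf : ContDiffAt ℝ (d + 1) f 0) :
    (fun y => f y - ∑ k ∈ Finset.range (d + 1),
      (k.factorial : ℝ)⁻¹ • iteratedFDeriv ℝ k f 0 fun _ => y) =O[𝓝 0]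
      fun y => ‖y‖ ^ (d + 1) := by
  have hcont : ContinuousAt (iteratedFDeriv ℝ (d + 1) f) 0 :=
    (hf.iteratedFDeriv_right (i := d + 1) (m := 0) (by simp)).continuousAt
  have hb : ∀ᶠ x in 𝓝 (0 : E), ‖iteratedFDeriv ℝ (d + 1) f x‖
      ≤ ‖iteratedFDeriv ℝ (d + 1) f 0‖ + 1 :=
    (hcont.norm.eventually (gt_mem_nhds (lt_add_one _))).mono fun x hx => le_of_lt hx
  have hc : ∀ᶠ x in 𝓝 (0 : E), ContDiffAt ℝ (d + 1) f x := by
    have := hf.eventually (by simp)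
    exact this
  obtain ⟨ε, hε, hball⟩ := Metric.eventually_nhds_iff_ball.1 (hb.and hc)
  set C := ‖iteratedFDeriv ℝ (d + 1) f 0‖ + 1
  refine IsBigO.of_bound ((d.factorial : ℝ)⁻¹ * C) ?_
  filter_upwards [Metric.ball_mem_nhds (0 : E) hε] with y hy
  have hmem : ∀ t ∈ Set.Icc (0 : ℝ) 1, (0 : E) + t • y ∈ Metric.ball (0 : E) ε := by
    intro t ht
    rw [mem_ball_zero_iff] at hy ⊢
    rw [zero_add, norm_smul, Real.norm_of_nonneg ht.1]
    exact lt_of_le_of_lt (mul_le_of_le_one_left (norm_nonneg _) ht.2) hy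
  have hT := map_add_eq_sum_add_integral_iteratedFDeriv (f := f) (x := 0) (y := y) (n := d)
    (fun t ht => (hball _ (hmem t ht)).2)
  rw [zero_add] at hT
  rw [hT, add_sub_cancel_left, norm_smul, norm_pow, norm_norm, norm_inv, mul_assoc]
  simp only [RCLike.norm_natCast]
  refine mul_le_mul_of_nonneg_left ?_ (by positivity)
  have := intervalIntegral.norm_integral_le_of_norm_le_const (a := (0 : ℝ)) (b := 1)
    (C := C * ‖y‖ ^ (d + 1))
    (f := fun t => (1 - t) ^ d • iteratedFDeriv ℝ (d + 1) f (0 + t • y) fun _ => y) ?_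
  · simpa using this
  · intro t ht
    rw [Set.uIoc_of_le zero_le_one] at ht
    have ht' : t ∈ Set.Icc (0 : ℝ) 1 := ⟨ht.1.le, ht.2⟩
    rw [norm_smul, norm_pow]
    have h1 : ‖1 - t‖ ^ d ≤ 1 := by
      refine pow_le_one₀ (norm_nonneg _) ?_
      rw [Real.norm_of_nonneg (by linarith [ht.2])]
      linarith [ht.1]
    have h2 : ‖iteratedFDeriv ℝ (d + 1) f (0 + t • y) fun _ => y‖ ≤ C * ‖y‖ ^ (d + 1) := by
      refine ((iteratedFDeriv ℝ (d + 1) f (0 + t • y)).le_opNorm _).trans ?_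
      simp only [Finset.prod_const, Finset.card_univ, Fintype.card_fin]
      exact mul_le_mul_of_nonneg_right (hball _ (hmem t ht')).1 (by positivity)
    calc _ ≤ 1 * (C * ‖y‖ ^ (d + 1)) := mul_le_mul h1 h2 (norm_nonneg _) zero_le_one
      _ = _ := one_mul _

/-- A smooth function that vanishes to order `d` agrees with its Taylor term of degree `d` up to
order `d + 1`. -/
theorem sub_leading_term_isBigO {f : E → F} {d : ℕ} (hf : ContDiffAt ℝ (d + 1) f 0)
    (hO : f =O[𝓝 0] fun y => ‖y‖ ^ d) :
    (fun y => f y - (d.factorial : ℝ)⁻¹ • iteratedFDeriv ℝ d f 0 fun _ => y) =O[𝓝 0]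
      fun y => ‖y‖ ^ (d + 1) := by
  induction d using Nat.strong_induction_on with
  | _ d ih =>
    -- Taylor terms below degree `d` vanish. By induction `f` minus its degree `k` term is `O(k +
    -- 1)`, and so is `f`; hence the homogeneous term is `O(k + 1)` and must be zero.
    have hlow : ∀ k < d, ∀ y, (k.factorial : ℝ)⁻¹ • (iteratedFDeriv ℝ k f 0 fun _ => y) = 0 := by
      intro k hk
      have h1 := ih k hk (hf.of_le (by exact_mod_cast Nat.succ_le_succ hk.le))
        (hO.trans (isBigO_pow_of_le hk.le))
      have h2 := (hO.trans (isBigO_pow_of_le hk)).sub h1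
      refine eq_zero_of_homogeneous_of_isBigO (k := k) ?_ (h2.congr_left fun y => by simp)
      intro t y
      have : (iteratedFDeriv ℝ k f 0 fun _ => t • y)
          = t ^ k • iteratedFDeriv ℝ k f 0 fun _ => y := by
        simpa using (iteratedFDeriv ℝ k f 0).map_smul_univ (fun _ => t) (fun _ => y)
      rw [this, smul_comm]
    refine (taylor_isBigO hf).congr_left fun y => ?_
    rw [Finset.sum_range_succ, Finset.sum_eq_zero fun k hk => hlow k (Finset.mem_range.1 hk) y,
      zero_add]

end Homogeneous

/-! ### Graphs -/

/-- The space `ℂⁿ × ℝ` with coordinates `(z, u)`. -/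
abbrev Yn (n : ℕ) : Type := (Fin n → ℂ) × ℝ

/-- The point `(z, u + iv)`. -/
def lift {n : ℕ} (y : Yn n) (v : ℝ) : Cn1 n := (y.1, ⟨y.2, v⟩)

/-- The real linear map `((z, u), v) ↦ (z, u + iv)`. -/
def liftL (n : ℕ) : Yn n × ℝ →L[ℝ] Cn1 n :=
  ((ContinuousLinearMap.fst ℝ _ _).comp (ContinuousLinearMap.fst ℝ (Yn n) ℝ)).prod
    (Complex.equivRealProdCLM.symm.toContinuousLinearMap.comp
      (((ContinuousLinearMap.snd ℝ _ _).comp (ContinuousLinearMap.fst ℝ (Yn n) ℝ)).prod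
        (ContinuousLinearMap.snd ℝ _ _)))

theorem liftL_apply {n : ℕ} (y : Yn n × ℝ) : liftL n y = lift y.1 y.2 := by
  refine Prod.ext rfl ?_
  apply Complex.ext <;> simp [liftL, lift, Complex.equivRealProdCLM_symm_apply]

/-- The real linear map `(z, u + iv) ↦ ((z, u), v)`. -/
def unliftL (n : ℕ) : Cn1 n →L[ℝ] Yn n × ℝ :=
  ((ContinuousLinearMap.fst ℝ _ _).prod
    (Complex.reCLM.comp (ContinuousLinearMap.snd ℝ _ _))).prod
    (Complex.imCLM.comp (ContinuousLinearMap.snd ℝ _ _))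

theorem unliftL_apply {n : ℕ} (x : Cn1 n) : unliftL n x = ((x.1, x.2.re), x.2.im) := rfl

theorem liftL_unliftL {n : ℕ} (x : Cn1 n) : liftL n (unliftL n x) = x := by
  rw [liftL_apply]; rfl

theorem norm_lift_sub_lift {n : ℕ} (y : Yn n) (v v' : ℝ) : ‖lift y v - lift y v'‖ = |v - v'| := by
  have h : lift y v - lift y v' = (0, ((v - v' : ℝ) : ℂ) * Complex.I) := by
    refine Prod.ext (by simp [lift]) ?_
    apply Complex.ext <;> simp [lift]
  rw [h, Prod.norm_mk, norm_mul, Complex.norm_real, Complex.norm_I, mul_one, norm_zero,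
    Real.norm_eq_abs, max_eq_right (abs_nonneg _)]

/-- The implicit function theorem together with an a posteriori estimate: an approximate solution
`N`, with residual `O(k)`, agrees with the true graph to order `k`. Taylor coefficients of `φ` can
thus be found by substitution, without differentiating `φ`. -/
theorem exists_graph {n : ℕ} {H : Cn1 n → ℝ} (hH : ∀ᶠ x in 𝓝 0, ContDiffAt ℝ ∞ H x)
    (h0 : H 0 = 0) (hd : ∀ x, fderiv ℝ H 0 x = x.2.im) {N : Yn n → ℝ}
    (hN : Tendsto N (𝓝 0) (𝓝 0)) {k : ℕ}
    (hk : (fun y => H (lift y (N y))) =O[𝓝 0] fun y => ‖y‖ ^ k) :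
    ∃ φ : Yn n → ℝ, (∀ᶠ y in 𝓝 0, ContDiffAt ℝ ∞ φ y) ∧ φ 0 = 0 ∧
      ((fun y => φ y - N y) =O[𝓝 0] fun y => ‖y‖ ^ k) ∧
      ∀ᶠ x in 𝓝 0, (H x = 0 ↔ x.2.im = φ (x.1, x.2.re)) := by
  set h : Yn n × ℝ → ℝ := fun y => H (liftL n y) with hh
  have hl0 : liftL n 0 = 0 := map_zero _
  have hl : Tendsto (liftL n) (𝓝 0) (𝓝 0) := by
    simpa [hl0] using (liftL n).continuous.tendsto 0
  have hsm : ∀ᶠ y in 𝓝 (0 : Yn n × ℝ), ContDiffAt ℝ ∞ h y :=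
    (hl.eventually hH).mono fun y hy => hy.comp y (liftL n).contDiff.contDiffAt
  have hcd : ContDiffAt ℝ ∞ h 0 := hsm.self_of_nhds
  have hHd : DifferentiableAt ℝ H 0 := hH.self_of_nhds.differentiableAt (by simp)
  have hinv : ∀ᶠ y in 𝓝 (0 : Yn n × ℝ),
      (fderiv ℝ h y ∘L .inr ℝ (Yn n) ℝ).IsInvertible := by
    have hcont : ContinuousAt (fun y => fderiv ℝ h y ∘L .inr ℝ (Yn n) ℝ) 0 := by
      have h1 : ContinuousAt (fderiv ℝ h) 0 :=
        (hcd.fderiv_right (m := 0) (by simp)).continuousAt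
      exact h1.clm_comp continuousAt_const
    have hat0 : fderiv ℝ h 0 ∘L .inr ℝ (Yn n) ℝ = ContinuousLinearEquiv.refl ℝ ℝ := by
      have h2 : HasFDerivAt h ((fderiv ℝ H 0).comp (liftL n)) 0 := by
        have h3 : HasFDerivAt H (fderiv ℝ H 0) (liftL n 0) := by
          rw [hl0]; exact hHd.hasFDerivAt
        exact h3.comp 0 (liftL n).hasFDerivAt
      rw [h2.fderiv]
      ext
      simp [hd, liftL_apply, lift]
    have := hcont.eventually (p := fun A => A.IsInvertible) ?_
    · exact this
    · simp only [hat0]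
      exact ContinuousLinearEquiv.nhds _
  set φ := hcd.implicitFunction (by simp) hinv.self_of_nhds with hφ
  have hφ0 : φ 0 = 0 := hcd.implicitFunction_apply_self (by simp) hinv.self_of_nhds
  have hiff : ∀ᶠ v in 𝓝 (0 : Yn n × ℝ), h v = 0 ↔ φ v.1 = v.2 := by
    have := hcd.eventually_apply_eq_iff_implicitFunction (by simp) hinv.self_of_nhds
    simpa [hh, hl0, h0] using this
  have hφc : ContinuousAt φ 0 :=
    (hcd.contDiffAt_implicitFunction (by simp) hinv.self_of_nhds).continuousAt
  have hφsm0 : ContDiffAt ℝ 1 φ 0 :=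
    (hcd.contDiffAt_implicitFunction (by simp) hinv.self_of_nhds).of_le (by simp)
  have hφcn : ∀ᶠ y in 𝓝 (0 : Yn n), ContinuousAt φ y :=
    (hφsm0.eventually (by simp)).mono fun y hy => hy.continuousAt
  have hpair : Tendsto (fun y => (y, φ y)) (𝓝 (0 : Yn n)) (𝓝 0) := by
    have : Tendsto (fun y => (y, φ y)) (𝓝 (0 : Yn n)) (𝓝 (0, φ 0)) :=
      (continuousAt_id (x := (0 : Yn n))).prodMk hφc
    rw [hφ0] at this
    exact this
  refine ⟨φ, ?_, hφ0, ?_, ?_⟩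
  -- The implicit function is smooth only at its base point, so smoothness at a nearby `y` comes
  -- from the implicit function based at `(y, φ y)`, which coincides with `φ` around `y`.
  · filter_upwards [hpair.eventually (hsm.and (hinv.and (eventually_eventually_nhds.2 hiff))),
      hφcn] with y ⟨hy1, hy2, hy3⟩ hy4
    have hy0 : h (y, φ y) = 0 := hy3.self_of_nhds.2 rfl
    refine (hy1.contDiffAt_implicitFunction (by simp) hy2).congr_of_eventuallyEq ?_
    have e1 := hy1.eventually_apply_eq_iff_implicitFunction (by simp) hy2
    have hp : Tendsto (fun y' => (y', φ y')) (𝓝 y) (𝓝 (y, φ y)) :=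
      (continuousAt_id (x := y)).prodMk hy4
    filter_upwards [hp.eventually (e1.and hy3)] with y' hy'
    exact (hy'.1.1 ((hy'.2.2 rfl).trans hy0.symm)).symm
  · have hst : HasStrictFDerivAt H (fderiv ℝ H 0) 0 :=
      hH.self_of_nhds.hasStrictFDerivAt (by simp)
    -- Since `dH = dv` at `0`, strict differentiability gives `|H(y, N) - H(y, φ) - (N - φ)| ≤ |N -
    -- φ| / 2`. With `H(y, φ) = 0` this yields `|φ - N| ≤ 2 |H(y, N)|`.
    have hlo := hst.isLittleO.bound (c := 1 / 2) (by norm_num)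
    have ha : Tendsto (fun y : Yn n => (lift y (N y), lift y (φ y))) (𝓝 0) (𝓝 ((0 : Cn1 n), 0)) := by
      have h1 : Tendsto (fun y : Yn n => (y, N y)) (𝓝 0) (𝓝 (0, 0)) :=
        tendsto_id.prodMk_nhds hN
      have h2 := (hl.comp h1).prodMk_nhds (hl.comp hpair)
      refine h2.congr fun y => ?_
      simp [liftL_apply]
    refine IsBigO.trans (IsBigO.of_bound 2 ?_) hk
    filter_upwards [ha.eventually hlo, hpair.eventually hiff] with y hy hy2
    have hb : H (lift y (φ y)) = 0 := by
      have := hy2.2 rfl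
      simpa [hh, liftL_apply] using this
    simp only [hb, sub_zero, norm_lift_sub_lift, hd] at hy
    have hi : (lift y (N y) - lift y (φ y)).2.im = N y - φ y := by simp [lift]
    rw [hi, Real.norm_eq_abs] at hy
    rw [Real.norm_eq_abs, Real.norm_eq_abs, abs_sub_comm]
    have := abs_sub_abs_le_abs_sub (N y - φ y) (H (lift y (N y)))
    rw [abs_sub_comm (N y - φ y) (H _)] at this
    linarith
  · have hu : Tendsto (unliftL n) (𝓝 0) (𝓝 0) := by
      simpa using (unliftL n).continuous.tendsto 0
    filter_upwards [hu.eventually hiff] with x hx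
    simp only [hh, liftL_unliftL] at hx
    rw [hx, unliftL_apply]
    exact eq_comm

/-! ### Tangent spaces and contact forms through a defining function -/

section Tangent

variable {n : ℕ} {M : Set (Cn1 n)} {p q : Cn1 n} {ρ : Cn1 n → ℝ}

theorem IsLocalDefining.eventually_contDiffAt (hρ : IsLocalDefining M q ρ) :
    ∀ᶠ x in 𝓝 q, ContDiffAt ℝ ∞ ρ x := by
  obtain ⟨U, hU, hq, hc, -, -⟩ := hρ
  filter_upwards [hU.mem_nhds hq] with x hx
  exact hc.contDiffAt (hU.mem_nhds hx)

theorem IsLocalDefining.eventually_mem_iff (hρ : IsLocalDefining M q ρ) :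
    ∀ᶠ x in 𝓝 q, (x ∈ M ↔ ρ x = 0) := by
  obtain ⟨U, hU, hq, -, -, h⟩ := hρ
  filter_upwards [hU.mem_nhds hq] with x hx using h x hx

theorem IsLocalDefining.of_eventually (hc : ∀ᶠ x in 𝓝 q, ContDiffAt ℝ ∞ ρ x)
    (hd : fderiv ℝ ρ q ≠ 0) (hM : ∀ᶠ x in 𝓝 q, (x ∈ M ↔ ρ x = 0)) : IsLocalDefining M q ρ := by
  obtain ⟨U, hUs, hU, hq⟩ := eventually_nhds_iff.1 (hc.and hM)
  exact ⟨U, hU, hq, fun x hx => (hUs x hx).1.contDiffWithinAt, hd, fun x hx => (hUs x hx).2⟩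

theorem IsLocalDefining.eventually (hρ : IsLocalDefining M p ρ) :
    ∀ᶠ q in 𝓝 p, IsLocalDefining M q ρ := by
  have hc := hρ.eventually_contDiffAt
  have hne : ∀ᶠ q in 𝓝 p, fderiv ℝ ρ q ≠ 0 := by
    have h1 : ContinuousAt (fderiv ℝ ρ) p :=
      (hc.self_of_nhds.fderiv_right (m := 0) (by simp)).continuousAt
    exact h1.eventually_ne hρ.choose_spec.2.2.2.1
  filter_upwards [eventually_eventually_nhds.2 hc, hne,
    eventually_eventually_nhds.2 hρ.eventually_mem_iff] with q h1 h2 h3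
  exact .of_eventually h1 h2 h3

/-- The kernel of `dρ` is the image of the differential of a local parametrization of `M`, along
which `h` vanishes. This makes the tangent space independent of `ρ`, and it allows identities valid
only on `M` to be differentiated in tangent directions. -/
theorem IsLocalDefining.fderiv_eq_zero (hρ : IsLocalDefining M q ρ) (hq : q ∈ M) {h : Cn1 n → ℝ}
    (hh : DifferentiableAt ℝ h q) (h0 : ∀ᶠ x in 𝓝 q, x ∈ M → h x = 0) {v : Cn1 n}
    (hv : fderiv ℝ ρ q v = 0) : fderiv ℝ h q v = 0 := by
  have hs : HasStrictFDerivAt ρ (fderiv ℝ ρ q) q :=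
    hρ.eventually_contDiffAt.self_of_nhds.hasStrictFDerivAt (by simp)
  have hne : fderiv ℝ ρ q ≠ 0 := hρ.choose_spec.2.2.2.1
  have hr : (fderiv ℝ ρ q).range = ⊤ := by
    refine LinearMap.range_eq_top.2 (LinearMap.surjective ?_)
    intro hz
    exact hne (ContinuousLinearMap.coe_injective hz)
  have hρq : ρ q = 0 := hρ.eventually_mem_iff.self_of_nhds.1 hq
  set g := hs.implicitFunction ρ (fderiv ℝ ρ q) hr (ρ q) with hg
  have hg0 : g 0 = q := hs.implicitFunction_apply_image hr
  have hgd : HasFDerivAt g (fderiv ℝ ρ q).ker.subtypeL 0 := (hs.to_implicitFunction hr).hasFDerivAt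
  have hzero : ∀ᶠ y in 𝓝 (0 : (fderiv ℝ ρ q).ker), ρ (g y) = 0 := by
    have h1 := hs.map_implicitFunction_eq hr
    have h2 : Tendsto (fun y : (fderiv ℝ ρ q).ker => (ρ q, y)) (𝓝 0) (𝓝 (ρ q, 0)) :=
      (Continuous.prodMk_right _).tendsto 0
    filter_upwards [h2.eventually h1] with y hy
    rw [hg, hy, hρq]
  have hgt : Tendsto g (𝓝 0) (𝓝 q) := by
    have := hgd.continuousAt.tendsto
    rwa [hg0] at this
  have hcomp : HasFDerivAt (h ∘ g) ((fderiv ℝ h q).comp (fderiv ℝ ρ q).ker.subtypeL) 0 := by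
    refine HasFDerivAt.comp 0 ?_ hgd
    rw [hg0]
    exact hh.hasFDerivAt
  have hev : h ∘ g =ᶠ[𝓝 0] fun _ => 0 := by
    filter_upwards [hzero, hgt.eventually (hρ.eventually_mem_iff.and h0)] with y hy1 hy2
    exact hy2.2 (hy2.1.2 hy1)
  have heq := hcomp.unique ((hasFDerivAt_const (0 : ℝ) _).congr_of_eventuallyEq hev)
  have := congrArg (fun A => A ⟨v, hv⟩) heq
  simpa using this

theorem IsLocalDefining.mem_tangentSpaceAt (hρ : IsLocalDefining M q ρ) (hq : q ∈ M) {v : Cn1 n} :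
    v ∈ tangentSpaceAt M q ↔ fderiv ℝ ρ q v = 0 := by
  simp only [tangentSpaceAt, Submodule.mem_iInf]
  constructor
  · intro h
    exact h ρ hρ
  · intro hv ρ' hρ'
    exact hρ.fderiv_eq_zero hq
      (hρ'.eventually_contDiffAt.self_of_nhds.differentiableAt (by simp))
      (hρ'.eventually_mem_iff.mono fun x hx => hx.1) hv

theorem IsLocalDefining.mem_complexTangentSpaceAt (hρ : IsLocalDefining M q ρ) (hq : q ∈ M)
    {v : Cn1 n} : v ∈ complexTangentSpaceAt M q ↔
      fderiv ℝ ρ q v = 0 ∧ fderiv ℝ ρ q (Complex.I • v) = 0 := by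
  rw [← hρ.mem_tangentSpaceAt hq, ← hρ.mem_tangentSpaceAt hq]
  rfl

theorem I_smul_I_smul (v : Cn1 n) : Complex.I • Complex.I • v = -v := by
  rw [smul_smul, Complex.I_mul_I, neg_one_smul]

/-- The differential of a 1-form at a fixed vector. -/
theorem differentiableAt_form_apply {Θ : Cn1 n → Cn1 n [⋀^Fin 1]→L[ℝ] ℝ}
    (hΘ : DifferentiableAt ℝ Θ p) (v : Fin 1 → Cn1 n) :
    DifferentiableAt ℝ (fun q => Θ q v) p := by
  fun_prop

theorem form_add (η : Cn1 n [⋀^Fin 1]→L[ℝ] ℝ) (a b : Cn1 n) :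
    η ![a + b] = η ![a] + η ![b] := by
  have := η.map_vecCons_add (n := 0) ![] a b
  exact this

theorem form_smul (η : Cn1 n [⋀^Fin 1]→L[ℝ] ℝ) (c : ℝ) (a : Cn1 n) :
    η ![c • a] = c * η ![a] := by
  have := η.map_vecCons_smul (n := 0) ![] c a
  exact this

/-- The second differential of `ρ`. -/
def hess (ρ : Cn1 n → ℝ) (p : Cn1 n) : Cn1 n →L[ℝ] Cn1 n →L[ℝ] ℝ := fderiv ℝ (fderiv ℝ ρ) p

theorem hess_symm (hρ : ContDiffAt ℝ ∞ ρ p) (a b : Cn1 n) : hess ρ p a b = hess ρ p b a :=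
  (hρ.isSymmSndFDerivAt (by simpa using ENat.LEInfty.out)) a b

theorem hasFDerivAt_fderiv_apply (hρ : ContDiffAt ℝ ∞ ρ p) (b : Cn1 n) :
    HasFDerivAt (fun q => fderiv ℝ ρ q b) ((hess ρ p).flip b) p := by
  have h1 : HasFDerivAt (fderiv ℝ ρ) (hess ρ p) p :=
    ((hρ.fderiv_right (m := 1) (WithTop.coe_le_coe.2 le_top)).differentiableAt (by simp)).hasFDerivAt
  exact (ContinuousLinearMap.apply ℝ ℝ b).hasFDerivAt.comp p h1

/-- The derivative along the complex tangent space of a form annihilating it. -/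
theorem fderiv_contact (hρ : IsLocalDefining M p ρ) (hp : p ∈ M)
    {Θ : Cn1 n → Cn1 n [⋀^Fin 1]→L[ℝ] ℝ} (hΘ : DifferentiableAt ℝ Θ p)
    (hann : ∀ᶠ q in 𝓝 p, q ∈ M → ∀ x ∈ complexTangentSpaceAt M q, Θ q ![x] = 0)
    {e a b : Cn1 n} (he : fderiv ℝ ρ p e = 1) (he' : fderiv ℝ ρ p (Complex.I • e) = 0)
    (ha : a ∈ complexTangentSpaceAt M p) (hb : b ∈ complexTangentSpaceAt M p) :
    fderiv ℝ (fun q => Θ q ![b]) p a =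
      hess ρ p a b * Θ p ![e] - hess ρ p a (Complex.I • b) * Θ p ![Complex.I • e] := by
  have hc := hρ.eventually_contDiffAt.self_of_nhds
  have hα := hasFDerivAt_fderiv_apply hc b
  have hβ := hasFDerivAt_fderiv_apply hc (Complex.I • b)
  have hγ := hasFDerivAt_fderiv_apply hc e
  have hδ := hasFDerivAt_fderiv_apply hc (Complex.I • e)
  have hΘb := (differentiableAt_form_apply hΘ ![b]).hasFDerivAt
  have hΘe := (differentiableAt_form_apply hΘ ![e]).hasFDerivAt
  have hΘIe := (differentiableAt_form_apply hΘ ![Complex.I • e]).hasFDerivAt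
  have hbker := (hρ.mem_complexTangentSpaceAt hp).1 hb
  have haker := (hρ.mem_complexTangentSpaceAt hp).1 ha
  have hΘb0 : Θ p ![b] = 0 := hann.self_of_nhds hp b hb
  -- At `q ∈ M`, subtracting a complex multiple of `e` moves `b` into the complex tangent space.
  -- Multiplied by `γ² + δ²`, the corrected vector has coefficients polynomial in the values `α, β,
  -- γ, δ` of `dρ` on `b, ib, e, ie`. The function differentiated here is `Θ` at that vector, so it
  -- vanishes on `M`.
  have hD := (((hγ.mul hγ).add (hδ.mul hδ)).mul hΘb).sub
    ((((hα.mul hγ).add (hβ.mul hδ)).mul hΘe).add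
      (((hα.mul hδ).sub (hβ.mul hγ)).mul hΘIe))
  have key := hρ.fderiv_eq_zero hp hD.differentiableAt ?_ haker.1
  · rw [hD.fderiv] at key
    simp [hbker.1, hbker.2, he, he', hΘb0] at key
    linarith
  · filter_upwards [hρ.eventually, hann] with q hq hq2 hqM
    simp only [Pi.add_apply, Pi.sub_apply, Pi.mul_apply]
    set α := fderiv ℝ ρ q b
    set β := fderiv ℝ ρ q (Complex.I • b)
    set γ := fderiv ℝ ρ q e
    set δ := fderiv ℝ ρ q (Complex.I • e)
    have hmem : (γ * γ + δ * δ) • b + (-(α * γ + β * δ)) • e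
        + (-(α * δ - β * γ)) • Complex.I • e ∈ complexTangentSpaceAt M q := by
      rw [hq.mem_complexTangentSpaceAt hqM]
      constructor
      · simp only [map_add, map_smul, smul_eq_mul]
        change (γ * γ + δ * δ) * α + (-(α * γ + β * δ)) * γ + (-(α * δ - β * γ)) * δ = 0
        ring
      · simp only [smul_add, smul_comm Complex.I (_ : ℝ), I_smul_I_smul, map_add, map_smul, map_neg,
          smul_eq_mul]
        change (γ * γ + δ * δ) * β + (-(α * γ + β * δ)) * δ + (-(α * δ - β * γ)) * -γ = 0
        ring
    have := hq2 hqM _ hmem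
    rw [form_add, form_add, form_smul, form_smul, form_smul] at this
    linarith

theorem extDeriv_pair {Θ : Cn1 n → Cn1 n [⋀^Fin 1]→L[ℝ] ℝ} (hΘ : DifferentiableAt ℝ Θ p)
    (a b : Cn1 n) : extDeriv Θ p ![a, b] =
      fderiv ℝ (fun q => Θ q ![b]) p a - fderiv ℝ (fun q => Θ q ![a]) p b := by
  rw [extDeriv_apply hΘ, Fin.sum_univ_two]
  have h0 : (0 : Fin 2).removeNth ![a, b] = ![b] := by ext i : 1; fin_cases i; rfl
  have h1 : (1 : Fin 2).removeNth ![a, b] = ![a] := by ext i : 1; fin_cases i; rfl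
  rw [h0, h1]
  simp [sub_eq_add_neg]

/-- Symmetry of the Hessian cancels every term with `Θ(e)` in `dΘ`; only those with `Θ(ie)` survive.
-/
theorem leviForm_self (hρ : IsLocalDefining M p ρ) (hp : p ∈ M)
    {Θ : Cn1 n → Cn1 n [⋀^Fin 1]→L[ℝ] ℝ} (hΘ : DifferentiableAt ℝ Θ p)
    (hann : ∀ᶠ q in 𝓝 p, q ∈ M → ∀ x ∈ complexTangentSpaceAt M q, Θ q ![x] = 0)
    {e a : Cn1 n} (he : fderiv ℝ ρ p e = 1) (he' : fderiv ℝ ρ p (Complex.I • e) = 0)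
    (ha : a ∈ complexTangentSpaceAt M p) :
    leviForm Θ p a a = ((Θ p ![Complex.I • e] / 2 *
      (hess ρ p a a + hess ρ p (Complex.I • a) (Complex.I • a)) : ℝ) : ℂ) := by
  have hIa : Complex.I • a ∈ complexTangentSpaceAt M p := Submodule.smul_mem _ _ ha
  have hF := fun {x y : Cn1 n} (hx : x ∈ complexTangentSpaceAt M p)
    (hy : y ∈ complexTangentSpaceAt M p) => fderiv_contact hρ hp hΘ hann he he' hx hy
  have hs := hess_symm hρ.eventually_contDiffAt.self_of_nhds (Complex.I • a) a
  simp only [leviForm, extDeriv_pair hΘ, hF ha ha, hF ha hIa, hF hIa ha, hF hIa hIa,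
    I_smul_I_smul, map_neg, hs]
  push_cast
  linear_combination (- (1 / 2) * (hess ρ p a a : ℂ) * (Θ p ![Complex.I • e]) - (1 / 2) *
    (hess ρ p (Complex.I • a) (Complex.I • a) : ℂ) * (Θ p ![Complex.I • e])) * Complex.I_mul_I

/-! ### Sesquilinearity of the Levi form. -/

theorem leviForm_add_left (Θ : Cn1 n → Cn1 n [⋀^Fin 1]→L[ℝ] ℝ) (a a' b : Cn1 n) :
    leviForm Θ p (a + a') b = leviForm Θ p a b + leviForm Θ p a' b := by
  have h : ∀ x y z : Cn1 n, extDeriv Θ p ![x + y, z] = extDeriv Θ p ![x, z] + extDeriv Θ p ![y, z] :=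
    fun x y z => (extDeriv Θ p).map_vecCons_add ![z] x y
  simp only [leviForm, smul_add, h]
  push_cast
  ring

theorem leviForm_smul_left (Θ : Cn1 n → Cn1 n [⋀^Fin 1]→L[ℝ] ℝ) (c : ℂ) (a b : Cn1 n) :
    leviForm Θ p (c • a) b = c * leviForm Θ p a b := by
  have hs : ∀ (r : ℝ) (y z : Cn1 n), extDeriv Θ p ![r • y, z] = r * extDeriv Θ p ![y, z] :=
    fun r y z => (extDeriv Θ p).map_vecCons_smul ![z] r y
  have hn : ∀ y z : Cn1 n, extDeriv Θ p ![-y, z] = -extDeriv Θ p ![y, z] := by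
    intro y z
    simpa using hs (-1) y z
  have hr : ∀ (r : ℝ) (a : Cn1 n), leviForm Θ p (r • a) b = r * leviForm Θ p a b := by
    intro r a
    simp only [leviForm, smul_comm Complex.I r, hs]
    push_cast
    ring
  have hI : leviForm Θ p (Complex.I • a) b = Complex.I * leviForm Θ p a b := by
    simp only [leviForm, I_smul_I_smul, hn]
    push_cast
    linear_combination (1 / 4 * (extDeriv Θ p ![a, Complex.I • b] : ℂ)
      - 1 / 4 * extDeriv Θ p ![Complex.I • a, b]) * Complex.I * Complex.I_sq
  have hdec : c • a = c.re • a + c.im • Complex.I • a := by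
    rw [← Complex.coe_smul c.re, ← Complex.coe_smul c.im, smul_smul, ← add_smul,
      Complex.re_add_im]
  rw [hdec, leviForm_add_left, hr, hr, hI]
  conv_rhs => rw [← Complex.re_add_im c]
  ring

theorem leviForm_sum_sum (Θ : Cn1 n → Cn1 n [⋀^Fin 1]→L[ℝ] ℝ) (x y : Fin n → ℂ)
    (b : Fin n → Cn1 n) : leviForm Θ p (∑ i, x i • b i) (∑ j, y j • b j) =
      ∑ i, ∑ j, x i * leviForm Θ p (b i) (b j) * conj (y j) := by
  have hz : ∀ c, leviForm Θ p 0 c = 0 := by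
    intro c
    simpa using leviForm_smul_left (p := p) Θ 0 0 c
  have hl : ∀ (x : Fin n → ℂ) (c : Cn1 n),
      leviForm Θ p (∑ i, x i • b i) c = ∑ i, x i * leviForm Θ p (b i) c := by
    intro x c
    let f : Cn1 n →+ ℂ := ⟨⟨fun a => leviForm Θ p a c, hz c⟩, fun a a' => leviForm_add_left Θ a a' c⟩
    have := map_sum f (fun i => x i • b i) Finset.univ
    refine this.trans (Finset.sum_congr rfl fun i _ => leviForm_smul_left Θ _ _ _)
  rw [hl]
  refine Finset.sum_congr rfl fun i _ => ?_
  rw [← leviForm_conj, hl, map_sum, Finset.mul_sum]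
  refine Finset.sum_congr rfl fun j _ => ?_
  rw [map_mul, leviForm_conj]
  ring

end Tangent

/-! ### A frame adapted to the contact form -/

/-- Sylvester's law: a Hermitian matrix with `ℓ` negative and `n - ℓ` positive eigenvalues is
congruent to the model matrix. -/
theorem exists_congruent_model {n ℓ : ℕ} (hℓ : ℓ ≤ n) {A : Matrix (Fin n) (Fin n) ℂ}
    (hA : A.IsHermitian) (hneg : (Finset.univ.filter fun i => hA.eigenvalues i < 0).card = ℓ)
    (hpos : (Finset.univ.filter fun i => 0 < hA.eigenvalues i).card = n - ℓ) :
    ∃ C : Matrix (Fin n) (Fin n) ℂ, ∀ k l,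
      ∑ i, ∑ j, C k i * A i j * conj (C l j) = if k = l then sgn ℓ k else 0 := by
  -- The two counts add up to `n`, which leaves no room for a zero eigenvalue.
  have hne : ∀ i, hA.eigenvalues i ≠ 0 := by
    have hdisj : Disjoint (Finset.univ.filter fun i => hA.eigenvalues i < 0)
        (Finset.univ.filter fun i => 0 < hA.eigenvalues i) := by
      rw [Finset.disjoint_filter]
      intro i _ h1 h2
      exact lt_asymm h1 h2
    have hun : (Finset.univ.filter fun i => hA.eigenvalues i < 0) ∪
        (Finset.univ.filter fun i => 0 < hA.eigenvalues i) = Finset.univ := by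
      rw [← Finset.card_eq_iff_eq_univ, Finset.card_union_of_disjoint hdisj, hneg, hpos,
        Fintype.card_fin]
      omega
    intro i
    have hi : i ∈ (Finset.univ.filter fun i => hA.eigenvalues i < 0) ∪
        (Finset.univ.filter fun i => 0 < hA.eigenvalues i) := by
      rw [hun]; exact Finset.mem_univ i
    rcases Finset.mem_union.1 hi with h | h
    · exact (Finset.mem_filter.1 h).2.ne
    · exact (Finset.mem_filter.1 h).2.ne'
  have hcard : Fintype.card {j : Fin n // (j : ℕ) < ℓ}
      = Fintype.card {i : Fin n // hA.eigenvalues i < 0} := by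
    rw [Fintype.card_subtype, Fintype.card_subtype, hneg]
    rcases hℓ.lt_or_eq with h | h
    · have : (Finset.univ.filter fun j : Fin n => (j : ℕ) < ℓ) = Finset.Iio ⟨ℓ, h⟩ := by
        ext j; simp [Fin.lt_def]
      rw [this, Fin.card_Iio]
    · subst h
      simp
  -- A permutation taking the first `ℓ` indices to the negative eigenvalues; the others then go to
  -- the positive ones.
  let e₀ := Fintype.equivOfCardEq hcard
  let e : Equiv.Perm (Fin n) := e₀.extendSubtype
  have he : ∀ k, ((|hA.eigenvalues (e k)| : ℝ) : ℂ)⁻¹ * (hA.eigenvalues (e k) : ℂ) = sgn ℓ k := by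
    intro k
    have h0 : (hA.eigenvalues (e k) : ℂ) ≠ 0 := by exact_mod_cast hne _
    by_cases hk : (k : ℕ) < ℓ
    · have : hA.eigenvalues (e k) < 0 := e₀.extendSubtype_mem k hk
      rw [abs_of_neg this, sgn, if_pos hk]
      push_cast
      field_simp
    · have : ¬ hA.eigenvalues (e k) < 0 := e₀.extendSubtype_not_mem k hk
      rw [abs_of_nonneg (not_lt.1 this), sgn, if_neg hk]
      field_simp
  set U : Matrix (Fin n) (Fin n) ℂ := hA.eigenvectorUnitary.1
  have hU : star U * A * U = Matrix.diagonal (fun i => (hA.eigenvalues i : ℂ)) := by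
    have := hA.conjStarAlgAut_star_eigenvectorUnitary
    rw [Unitary.conjStarAlgAut_star_apply] at this
    exact this
  -- Scaling each eigenvector by `|λ|^(-1/2)` turns the eigenvalue `λ` into its sign.
  let r : Fin n → ℝ := fun k => (√|hA.eigenvalues (e k)|)⁻¹
  have hr : ∀ k, (r k : ℂ) * r k = ((|hA.eigenvalues (e k)| : ℝ) : ℂ)⁻¹ := by
    intro k
    rw [← Complex.ofReal_mul, ← mul_inv, Real.mul_self_sqrt (abs_nonneg _), Complex.ofReal_inv]
  refine ⟨fun k i => r k * star U (e k) i, fun k l => ?_⟩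
  have hent := congrFun (congrFun hU (e k)) (e l)
  rw [Matrix.mul_apply] at hent
  simp only [Matrix.mul_apply, Finset.sum_mul] at hent
  rw [Finset.sum_comm] at hent
  have : ∑ i, ∑ j, (r k * star U (e k) i) * A i j * conj ((r l : ℂ) * star U (e l) j)
      = r k * r l * ∑ i, ∑ j, star U (e k) i * A i j * U j (e l) := by
    simp only [Finset.mul_sum]
    refine Finset.sum_congr rfl fun i _ => Finset.sum_congr rfl fun j _ => ?_
    have : conj (star U (e l) j) = U j (e l) := by
      simp [Matrix.star_apply]
    rw [map_mul, this, Complex.conj_ofReal]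
    ring
  rw [this, hent, Matrix.diagonal_apply]
  by_cases hkl : k = l
  · subst hkl
    rw [if_pos rfl, if_pos rfl, hr, he]
  · rw [if_neg hkl, if_neg (fun h => hkl (e.injective h)), mul_zero]

theorem normSqL_eq_re {n : ℕ} (ℓ : ℕ) (z : Fin n → ℂ) : ((normSqL ℓ z).re : ℂ) = normSqL ℓ z := by
  rw [← Complex.conj_eq_iff_re, normSqL, map_sum]
  refine Finset.sum_congr rfl fun j _ => ?_
  have : conj (sgn ℓ j) = sgn ℓ j := by
    unfold sgn; split_ifs <;> simp
  rw [map_mul, map_mul, this, Complex.conj_conj, mul_comm (conj (z j))]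

/-- The complex linear form `x ↦ D x - i D(ix)` is not zero; `e` is the complex multiple of `x` on
which it equals `1`. -/
theorem exists_normal_vector {n : ℕ} {D : Cn1 n →L[ℝ] ℝ} (hD : D ≠ 0) :
    ∃ e, D e = 1 ∧ D (Complex.I • e) = 0 := by
  obtain ⟨x, hx⟩ : ∃ x, D x ≠ 0 := by
    by_contra! h
    exact hD (ContinuousLinearMap.ext h)
  have hne : D x ^ 2 + D (Complex.I • x) ^ 2 ≠ 0 := by positivity
  refine ⟨(D x / (D x ^ 2 + D (Complex.I • x) ^ 2)) • x +
    (D (Complex.I • x) / (D x ^ 2 + D (Complex.I • x) ^ 2)) • Complex.I • x, ?_, ?_⟩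
  · simp only [map_add, map_smul, smul_eq_mul]
    field_simp
  · simp only [smul_add, smul_comm Complex.I (_ : ℝ), I_smul_I_smul, map_add, map_smul, map_neg,
      smul_eq_mul]
    ring

/-- The columns of `T` are a complex tangent frame diagonalizing the Levi form and a multiple of
`ie`. With `κ = Θ(ie)`, that multiple `1/(2κ)` gives `θ ∘ T = u/2`, which forces `c = -2κ` for `c dρ
∘ T = dv`. As the Levi form is `κ/2` times the complex Hessian, the factor `-4` results. -/
theorem exists_adapted_frame {n ℓ : ℕ} (hℓ : ℓ ≤ n) {M : Set (Cn1 n)} {p : Cn1 n} (hp : p ∈ M)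
    {ρ : Cn1 n → ℝ} (hρ : IsLocalDefining M p ρ) {θ : tangentSpaceAt M p →ₗ[ℝ] ℝ}
    (hθ : IsAppropriateContactForm M ℓ p θ) :
    ∃ (T : Cn1 n ≃L[ℂ] Cn1 n) (c : ℝ), c ≠ 0 ∧ (∀ x, c * fderiv ℝ ρ p (T x) = x.2.im) ∧
      (∀ z, c * (hess ρ p (T (z, 0)) (T (z, 0)) +
        hess ρ p (T (Complex.I • z, 0)) (T (Complex.I • z, 0))) = -4 * (normSqL ℓ z).re) ∧
      ∀ x (hx : T x ∈ tangentSpaceAt M p), θ ⟨T x, hx⟩ = x.2.re / 2 := by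
  obtain ⟨hθ0, hθann, Θ, ⟨⟨U, hU, hpU, hΘc, hΘann⟩, hext⟩, b, hneg, hpos⟩ := hθ
  have hΘ : DifferentiableAt ℝ Θ p :=
    (hΘc.contDiffAt (hU.mem_nhds hpU)).differentiableAt (by simp)
  have hann : ∀ᶠ q in 𝓝 p, q ∈ M → ∀ x ∈ complexTangentSpaceAt M q, Θ q ![x] = 0 := by
    filter_upwards [hU.mem_nhds hpU] with q hq hqM using hΘann q ⟨hqM, hq⟩
  obtain ⟨e, he, he'⟩ := exists_normal_vector hρ.choose_spec.2.2.2.1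
  set D := fderiv ℝ ρ p with hDdef
  set κ := Θ p ![Complex.I • e] with hκdef
  -- A tangent vector `t` lies in the complex tangent space after adding `D(it) · ie`, so `κ = 0`
  -- would force `θ = 0`.
  have hκ : κ ≠ 0 := by
    intro hκ0
    apply hθ0
    ext t
    rw [LinearMap.zero_apply, ← hext t]
    have ht : D t = 0 := (hρ.mem_tangentSpaceAt hp).1 t.2
    have hmem : (t : Cn1 n) + D (Complex.I • (t : Cn1 n)) • Complex.I • e
        ∈ complexTangentSpaceAt M p := by
      rw [hρ.mem_complexTangentSpaceAt hp]
      constructor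
      · simp [ht, he', ← hDdef]
      · simp [smul_comm Complex.I (_ : ℝ), I_smul_I_smul, he, ← hDdef]
    have := hann.self_of_nhds hp _ hmem
    rw [form_add, form_smul, ← hκdef, hκ0, mul_zero, add_zero] at this
    exact this
  obtain ⟨C, hC⟩ := exists_congruent_model hℓ _ hneg hpos
  set f : Fin n → Cn1 n := fun k => ∑ i, C k i • (b i : Cn1 n) with hf
  have hfmem : ∀ k, f k ∈ complexTangentSpaceAt M p := fun k =>
    Submodule.sum_mem _ fun i _ => Submodule.smul_mem _ _ (b i).2
  have hfL : ∀ k l, leviForm Θ p (f k) (f l) = if k = l then sgn ℓ k else 0 := by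
    intro k l
    rw [hf, leviForm_sum_sum, ← hC k l]
    rfl
  let τ : ℝ := 1 / (2 * κ)
  let T₀ : Cn1 n →ₗ[ℂ] Cn1 n :=
    (Fintype.linearCombination ℂ f).comp (LinearMap.fst ℂ _ _) +
      (LinearMap.toSpanSingleton ℂ (Cn1 n) (τ • Complex.I • e)).comp (LinearMap.snd ℂ _ _)
  have hT₀ : ∀ x : Cn1 n, T₀ x = (∑ k, x.1 k • f k) + x.2 • τ • Complex.I • e := by
    intro x
    simp [T₀, Fintype.linearCombination_apply]
  have hzmem : ∀ z : Fin n → ℂ, ∑ k, z k • f k ∈ complexTangentSpaceAt M p := fun z =>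
    Submodule.sum_mem _ fun i _ => Submodule.smul_mem _ _ (hfmem i)
  have hw : ∀ w : ℂ, w • τ • Complex.I • e = (w.re * τ) • Complex.I • e + (-(w.im * τ)) • e := by
    intro w
    have : w • τ • Complex.I • e = (w.re • τ • Complex.I • e) + w.im • Complex.I • τ • Complex.I • e
        := by
      rw [← Complex.coe_smul w.re, ← Complex.coe_smul w.im, smul_smul (w.im : ℂ), ← add_smul,
        Complex.re_add_im]
    rw [this, smul_comm Complex.I τ, I_smul_I_smul, smul_neg, smul_neg, smul_smul, smul_smul,
      neg_smul]
  have hDz : ∀ z : Fin n → ℂ, D (∑ k, z k • f k) = 0 ∧ D (Complex.I • ∑ k, z k • f k) = 0 :=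
    fun z => (hρ.mem_complexTangentSpaceAt hp).1 (hzmem z)
  have hDT : ∀ x, D (T₀ x) = -(x.2.im * τ) := by
    intro x
    rw [hT₀, map_add, (hDz _).1, hw, map_add, D.map_smul, D.map_smul, he, he']
    simp
  have hτ : τ ≠ 0 := by positivity
  have hLz : ∀ z z' : Fin n → ℂ, leviForm Θ p (∑ k, z k • f k) (∑ k, z' k • f k)
      = ∑ j, sgn ℓ j * (z j * conj (z' j)) := by
    intro z z'
    rw [leviForm_sum_sum]
    refine Finset.sum_congr rfl fun j _ => ?_
    simp only [hfL]
    rw [Finset.sum_eq_single j]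
    · rw [if_pos rfl]; ring
    · intro k _ hk
      rw [if_neg (Ne.symm hk)]; ring
    · simp
  -- On the kernel, `D` applied to `T₀ x` and `T₀ (ix)` kills the `w` component. Pairing with each
  -- frame vector under the nondegenerate Levi form then kills `z`.
  have hinj : Function.Injective T₀ := by
    rw [injective_iff_map_eq_zero]
    intro x hx
    have him : x.2.im = 0 := by
      have := hDT x
      rw [hx, map_zero] at this
      have h2 : x.2.im * τ = 0 := by linarith
      exact (mul_eq_zero.1 h2).resolve_right hτ
    have hre : x.2.re = 0 := by
      have h1 := hDT (Complex.I • x)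
      rw [map_smul, hx, smul_zero, map_zero] at h1
      have h2 : (Complex.I • x).2.im = x.2.re := by simp
      rw [h2] at h1
      have h3 : x.2.re * τ = 0 := by linarith
      exact (mul_eq_zero.1 h3).resolve_right hτ
    have hx2 : x.2 = 0 := Complex.ext hre him
    rw [hT₀, hx2, zero_smul, add_zero] at hx
    refine Prod.ext ?_ hx2
    funext k
    have h1 := hLz x.1 (Pi.single k 1)
    have h0 : leviForm Θ p 0 (∑ j, (Pi.single k 1 : Fin n → ℂ) j • f j) = 0 := by
      simpa using leviForm_smul_left (p := p) Θ 0 0 (∑ j, (Pi.single k 1 : Fin n → ℂ) j • f j)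
    rw [hx, h0, Finset.sum_eq_single k] at h1
    · have hs : sgn ℓ k ≠ 0 := by unfold sgn; split_ifs <;> simp
      simpa [hs] using h1.symm
    · intro j _ hj
      simp [Pi.single_eq_of_ne hj]
    · simp
  let T : Cn1 n ≃L[ℂ] Cn1 n := (LinearEquiv.ofInjectiveEndo T₀ hinj).toContinuousLinearEquiv
  have hT : ∀ x, T x = T₀ x := fun x => rfl
  have hTz : ∀ z, T (z, 0) = ∑ k, z k • f k := by
    intro z
    rw [hT, hT₀]
    simp
  refine ⟨T, -2 * κ, mul_ne_zero (by norm_num) hκ, ?_, ?_, ?_⟩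
  · intro x
    rw [hT, hDT]
    simp only [τ]
    field_simp
  · intro z
    have hI : T (Complex.I • z, 0) = Complex.I • T (z, 0) := by
      rw [← map_smul]
      simp
    rw [hI, hTz]
    have h1 := leviForm_self hρ hp hΘ hann he he' (hzmem z)
    rw [hLz z z] at h1
    change normSqL ℓ z = _ at h1
    rw [← normSqL_eq_re] at h1
    have h2 := Complex.ofReal_injective h1
    rw [h2]
    ring
  · intro x hx
    have h1 : x.2.im = 0 := by
      have h2 := (hρ.mem_tangentSpaceAt hp).1 hx
      rw [hT, ← hDdef, hDT] at h2
      have h3 : x.2.im * τ = 0 := by linarith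
      exact (mul_eq_zero.1 h3).resolve_right hτ
    rw [← hext]
    change Θ p ![T x] = _
    rw [hT, hT₀, form_add, hann.self_of_nhds hp _ (hzmem _), hw, form_add, form_smul, form_smul, h1,
      ← hκdef]
    simp only [τ]
    field_simp
    ring

/-! ### Holomorphic changes of coordinates and graphs -/

section Charts

variable {n : ℕ}

/-- In the coordinates given by the holomorphic map `Γ`, with `Γ 0 = p` and differential `T` at
`0`, the set `M` is near `0` the graph `v = φ(z, u)`. -/
structure IsGraphChart (M : Set (Cn1 n)) (p : Cn1 n) (T : Cn1 n ≃L[ℂ] Cn1 n)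
    (Γ : Cn1 n → Cn1 n) (φ : Yn n → ℝ) : Prop where
  contDiff : ContDiff ℂ ∞ Γ
  apply_zero : Γ 0 = p
  hasFDerivAt : HasFDerivAt Γ (T : Cn1 n →L[ℂ] Cn1 n) 0
  smooth : ∀ᶠ y in 𝓝 0, ContDiffAt ℝ ∞ φ y
  zero : φ 0 = 0
  mem_iff : ∀ᶠ x in 𝓝 0, (Γ x ∈ M ↔ x.2.im = φ (x.1, x.2.re))

theorem hasFDerivAt_zero_of_isBigO {𝕜 E F : Type*} [NontriviallyNormedField 𝕜]
    [NormedAddCommGroup E] [NormedSpace 𝕜 E] [NormedAddCommGroup F] [NormedSpace 𝕜 F]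
    {f : E → F} (hf : f =O[𝓝 0] fun x => ‖x‖ ^ 2) : HasFDerivAt f (0 : E →L[𝕜] F) 0 := by
  have h0 : f 0 = 0 := by
    obtain ⟨C, hC⟩ := hf.bound
    simpa using hC.self_of_nhds
  rw [hasFDerivAt_iff_isLittleO]
  simp only [h0, sub_zero, zero_apply]
  refine hf.trans_isLittleO ?_
  have h1 : (fun x : E => ‖x‖ ^ 2) =o[𝓝 0] fun x => ‖x‖ ^ 1 := by
    have := (isLittleO_pow_pow (𝕜 := ℝ) (m := 1) (n := 2) (by norm_num)).comp_tendsto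
      (tendsto_norm_zero (E := E))
    exact this
  refine IsLittleO.of_norm_right ?_
  simpa using h1

/-- In the new coordinates the equation is `Im G₂ - φ(G₁, Re G₂) = 0`. Its differential at `0` is
`dv`, because `φ` has none there and `G` is tangent to the identity, so `exists_graph` applies with
`N` as approximate solution. Tangency to the identity also keeps `T` unchanged. -/
theorem IsGraphChart.change {M : Set (Cn1 n)} {p : Cn1 n} {T : Cn1 n ≃L[ℂ] Cn1 n}
    {Γ : Cn1 n → Cn1 n} {φ : Yn n → ℝ} (h : IsGraphChart M p T Γ φ)
    (hφ : φ =O[𝓝 0] fun y => ‖y‖ ^ 2) {G : Cn1 n → Cn1 n} (hG : ContDiff ℂ ∞ G) (hG0 : G 0 = 0)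
    (hG' : HasFDerivAt G (ContinuousLinearMap.id ℂ (Cn1 n)) 0) {N : Yn n → ℝ}
    (hN : Tendsto N (𝓝 0) (𝓝 0)) {k : ℕ}
    (hk : (fun y => (G (lift y (N y))).2.im - φ ((G (lift y (N y))).1, (G (lift y (N y))).2.re))
      =O[𝓝 0] fun y => ‖y‖ ^ k) :
    ∃ φ', IsGraphChart M p T (Γ ∘ G) φ' ∧ (fun y => φ' y - N y) =O[𝓝 0] fun y => ‖y‖ ^ k := by
  have hGt : Tendsto G (𝓝 0) (𝓝 0) := by
    have := hG.continuous.tendsto 0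
    rwa [hG0] at this
  let A : Cn1 n →L[ℝ] Yn n := (ContinuousLinearMap.fst ℝ _ _).comp (unliftL n)
  have hA : ∀ x, A x = (x.1, x.2.re) := fun x => rfl
  let B : Cn1 n →L[ℝ] ℝ := (ContinuousLinearMap.snd ℝ _ _).comp (unliftL n)
  have hB : ∀ x, B x = x.2.im := fun x => rfl
  have hAt : Tendsto A (𝓝 0) (𝓝 0) := by simpa using A.continuous.tendsto 0
  have hGR : ContDiff ℝ ∞ G := hG.restrict_scalars ℝ
  obtain ⟨φ', hsm, h0, hO, hiff⟩ := exists_graph (H := fun x => B (G x) - φ (A (G x))) (n := n)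
    (by
      filter_upwards [(hAt.comp hGt).eventually h.smooth] with x hx
      have h1 : ContDiffAt ℝ ∞ (fun x => A (G x)) x := A.contDiff.contDiffAt.comp x hGR.contDiffAt
      exact (B.contDiff.contDiffAt.comp x hGR.contDiffAt).sub (ContDiffAt.comp x hx h1))
    (by simp [hG0, h.zero]) (by
      intro x
      have hGd : HasFDerivAt G (ContinuousLinearMap.id ℝ (Cn1 n)) 0 := hG'.restrictScalars ℝ
      have h1 : HasFDerivAt (fun x => B (G x)) (B.comp (ContinuousLinearMap.id ℝ (Cn1 n))) 0 :=
        B.hasFDerivAt.comp 0 hGd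
      have h2 : HasFDerivAt (fun x => A (G x)) (A.comp (ContinuousLinearMap.id ℝ (Cn1 n))) 0 :=
        A.hasFDerivAt.comp 0 hGd
      have h3 : HasFDerivAt φ (0 : Yn n →L[ℝ] ℝ) (A (G 0)) := by
        rw [hG0, map_zero]
        exact hasFDerivAt_zero_of_isBigO hφ
      have h4 := h1.sub (h3.comp 0 h2)
      have h5 : fderiv ℝ (fun x => B (G x) - φ (A (G x))) 0 = _ := h4.fderiv
      rw [h5]
      simp [hB]) hN hk
  refine ⟨φ', ⟨h.contDiff.comp hG, by simp [hG0, h.apply_zero], ?_, hsm, h0, ?_⟩, hO⟩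
  · have h1 : HasFDerivAt Γ (T : Cn1 n →L[ℂ] Cn1 n) (G 0) := by
      rw [hG0]; exact h.hasFDerivAt
    exact h1.comp 0 hG'
  · filter_upwards [hGt.eventually h.mem_iff, hiff] with x hx1 hx2
    rw [Function.comp_apply, hx1, ← hx2, hB, hA, sub_eq_zero]

/-! ### The model quadratic form: polarization and growth. -/

/-- The real quadratic form `|z|_ℓ²`. -/
def qf (ℓ : ℕ) (z : Fin n → ℂ) : ℝ := (normSqL ℓ z).re

/-- The real part of the Hermitian form associated with `|z|_ℓ²`. -/
def hermRe (ℓ : ℕ) (f z : Fin n → ℂ) : ℝ := (∑ j, sgn ℓ j * (f j * conj (z j))).re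

theorem sgn_eq_ofReal (ℓ : ℕ) (j : Fin n) :
    sgn ℓ j = ((if (j : ℕ) < ℓ then -1 else 1 : ℝ) : ℂ) := by
  unfold sgn; split_ifs <;> simp

theorem qf_add (ℓ : ℕ) (z f : Fin n → ℂ) : qf ℓ (z + f) = qf ℓ z + 2 * hermRe ℓ f z + qf ℓ f := by
  simp only [qf, normSqL, hermRe, Complex.re_sum, Finset.mul_sum, ← Finset.sum_add_distrib]
  refine Finset.sum_congr rfl fun j _ => ?_
  rw [sgn_eq_ofReal]
  generalize (if (j : ℕ) < ℓ then -1 else 1 : ℝ) = c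
  rw [Complex.re_ofReal_mul, Complex.re_ofReal_mul, Complex.re_ofReal_mul, Complex.re_ofReal_mul]
  simp only [ Pi.add_apply, map_add, Complex.mul_re, Complex.add_re,
    Complex.add_im, Complex.conj_re, Complex.conj_im]
  ring

theorem abs_hermRe_le (ℓ : ℕ) (f z : Fin n → ℂ) : |hermRe ℓ f z| ≤ n * (‖f‖ * ‖z‖) := by
  refine (Complex.abs_re_le_norm _).trans ((norm_sum_le _ _).trans ?_)
  have : ∀ j ∈ Finset.univ, ‖sgn ℓ j * (f j * conj (z j))‖ ≤ ‖f‖ * ‖z‖ := by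
    intro j _
    have hs : ‖sgn ℓ j‖ = 1 := by unfold sgn; split_ifs <;> simp
    rw [norm_mul, norm_mul, hs, one_mul, RCLike.norm_conj]
    exact mul_le_mul (norm_le_pi_norm f j) (norm_le_pi_norm z j) (norm_nonneg _) (norm_nonneg _)
  simpa using Finset.sum_le_card_nsmul _ _ _ this

theorem qf_eq_hermRe (ℓ : ℕ) (z : Fin n → ℂ) : qf ℓ z = hermRe ℓ z z := rfl

theorem abs_qf_le (ℓ : ℕ) (z : Fin n → ℂ) : |qf ℓ z| ≤ n * ‖z‖ ^ 2 := by
  rw [qf_eq_hermRe, sq]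
  exact abs_hermRe_le ℓ z z

theorem qf_isBigO (ℓ : ℕ) : (fun y : Yn n => qf ℓ y.1) =O[𝓝 0] fun y => ‖y‖ ^ 2 := by
  refine IsBigO.of_bound n (Eventually.of_forall fun y => ?_)
  rw [Real.norm_eq_abs, norm_pow, norm_norm]
  refine (abs_qf_le ℓ y.1).trans ?_
  have : ‖y.1‖ ≤ ‖y‖ := norm_fst_le y
  gcongr

theorem norm_lift_le (y : Yn n) (v : ℝ) : ‖lift y v‖ ≤ ‖y‖ + |v| := by
  rw [lift, Prod.norm_mk]
  refine max_le ((norm_fst_le y).trans (by linarith [abs_nonneg v])) ?_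
  refine (Complex.norm_le_abs_re_add_abs_im _).trans ?_
  have : |y.2| ≤ ‖y‖ := norm_snd_le y
  simpa using this

theorem lift_isBigO {N : Yn n → ℝ} (hN : N =O[𝓝 0] fun y => ‖y‖ ^ 2) :
    (fun y => lift y (N y)) =O[𝓝 0] fun y : Yn n => ‖y‖ := by
  have h1 : N =O[𝓝 0] fun y => ‖y‖ := by
    simpa using hN.trans (isBigO_pow_of_le (k := 1) (m := 2) (by norm_num))
  refine IsBigO.trans ?_ ((isBigO_refl (fun y : Yn n => ‖y‖) (𝓝 0)).add h1.norm_left)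
  refine IsBigO.of_bound 1 (Eventually.of_forall fun y => ?_)
  rw [one_mul]
  exact (norm_lift_le y (N y)).trans (le_abs_self _)

theorem tendsto_zero_of_isBigO_pow {E F : Type*} [NormedAddCommGroup E] [NormedAddCommGroup F]
    {f : E → F} {k : ℕ} (hk : k ≠ 0) (hf : f =O[𝓝 0] fun x => ‖x‖ ^ k) :
    Tendsto f (𝓝 0) (𝓝 0) := by
  refine hf.trans_tendsto ?_
  have : Tendsto (fun x : E => ‖x‖ ^ k) (𝓝 0) (𝓝 (‖(0 : E)‖ ^ k)) :=
    (continuous_norm.pow k).tendsto 0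
  simpa [hk] using this

/-- The mean value bound costs `d - 1` factors of size `‖y‖` and one factor `δ` of order 2, in total
`d + 1`. -/
theorem multilinear_diag_sub_isBigO {d : ℕ} (hd : 1 ≤ d)
    (m : ContinuousMultilinearMap ℝ (fun _ : Fin d => Yn n) ℝ)
    {δ : Yn n → Yn n} (hδ : δ =O[𝓝 0] fun y => ‖y‖ ^ 2) :
    (fun y => (m fun _ => y + δ y) - m fun _ => y) =O[𝓝 0] fun y => ‖y‖ ^ (d + 1) := by
  obtain ⟨C, hC⟩ := hδ.bound
  refine IsBigO.of_bound (‖m‖ * d * (1 + |C|) ^ (d - 1) * |C|) ?_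
  filter_upwards [hC, Metric.ball_mem_nhds (0 : Yn n) one_pos] with y hy hy1
  rw [mem_ball_zero_iff] at hy1
  rw [norm_pow, norm_norm] at hy ⊢
  have hy' : ‖δ y‖ ≤ |C| * ‖y‖ ^ 2 := hy.trans (by gcongr; exact le_abs_self C)
  have hsum : ‖y + δ y‖ ≤ (1 + |C|) * ‖y‖ := by
    refine (norm_add_le _ _).trans ?_
    have : |C| * ‖y‖ ^ 2 ≤ |C| * ‖y‖ := by
      gcongr
      nlinarith [norm_nonneg y]
    linarith
  have hself : ‖y‖ ≤ (1 + |C|) * ‖y‖ := by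
    nlinarith [norm_nonneg y, abs_nonneg C]
  refine (m.norm_image_sub_le (fun _ => y + δ y) (fun _ => y)).trans ?_
  have hpc : ∀ v : Yn n, ‖(fun _ : Fin d => v)‖ ≤ ‖v‖ := fun v => pi_norm_const_le v
  have hdiff : ‖(fun _ : Fin d => y + δ y) - fun _ => y‖ ≤ |C| * ‖y‖ ^ 2 := by
    have : ((fun _ : Fin d => y + δ y) - fun _ => y) = fun _ => δ y := by
      funext i; simp
    rw [this]
    exact (hpc _).trans hy'
  have hmax : max ‖(fun _ : Fin d => y + δ y)‖ ‖(fun _ : Fin d => y)‖ ≤ (1 + |C|) * ‖y‖ :=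
    max_le ((hpc _).trans hsum) ((hpc _).trans hself)
  rw [Fintype.card_fin]
  calc _ ≤ ‖m‖ * d * ((1 + |C|) * ‖y‖) ^ (d - 1) * (|C| * ‖y‖ ^ 2) := by gcongr
    _ = _ := by
      obtain ⟨k, rfl⟩ : ∃ k, d = k + 1 := ⟨d - 1, by omega⟩
      rw [Nat.add_sub_cancel, mul_pow]
      ring

/-- One step of the normalization: the effect of the map `(z, w) ↦ (z + f(z, w), w + g(z, w))`
on a graph `v = |z|_ℓ² + P + O(d + 1)`. -/
theorem IsGraphChart.normalize {M : Set (Cn1 n)} {p : Cn1 n} {T : Cn1 n ≃L[ℂ] Cn1 n}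
    {Γ : Cn1 n → Cn1 n} {φ : Yn n → ℝ} (h : IsGraphChart M p T Γ φ) (ℓ : ℕ) {d : ℕ} (hd : 2 ≤ d)
    (m : ContinuousMultilinearMap ℝ (fun _ : Fin d => Yn n) ℝ)
    (hφ : (fun y => φ y - (qf ℓ y.1 + m fun _ => y)) =O[𝓝 0] fun y => ‖y‖ ^ (d + 1))
    {f : Cn1 n → Fin n → ℂ} {g : Cn1 n → ℂ} (hf : ContDiff ℂ ∞ f) (hg : ContDiff ℂ ∞ g)
    (hfO : f =O[𝓝 0] fun x => ‖x‖ ^ 2) (hgO : g =O[𝓝 0] fun x => ‖x‖ ^ 2)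
    {N : Yn n → ℝ} (hN : N =O[𝓝 0] fun y => ‖y‖ ^ 2)
    (hK : (fun y => N y + (g (lift y (N y))).im - qf ℓ y.1 - 2 * hermRe ℓ (f (lift y (N y))) y.1
      - qf ℓ (f (lift y (N y))) - m fun _ => y) =O[𝓝 0] fun y => ‖y‖ ^ (d + 1)) :
    ∃ Γ' φ', IsGraphChart M p T Γ' φ' ∧
      (fun y => φ' y - N y) =O[𝓝 0] fun y => ‖y‖ ^ (d + 1) := by
  have hφ2 : φ =O[𝓝 0] fun y => ‖y‖ ^ 2 := by
    have h1 := (hφ.trans (isBigO_pow_of_le (by omega : 2 ≤ d + 1))).add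
      ((qf_isBigO ℓ).add ((multilinear_diag_isBigO m).trans (isBigO_pow_of_le hd)))
    refine h1.congr_left fun y => by simp
  have hf0 : f 0 = 0 := by
    obtain ⟨C, hC⟩ := hfO.bound
    simpa using hC.self_of_nhds
  have hg0 : g 0 = 0 := by
    obtain ⟨C, hC⟩ := hgO.bound
    simpa using hC.self_of_nhds
  set G : Cn1 n → Cn1 n := fun x => (x.1 + f x, x.2 + g x) with hGdef
  have hG : ContDiff ℂ ∞ G := (contDiff_fst.add hf).prodMk (contDiff_snd.add hg)
  have hG0 : G 0 = 0 := by simp [hGdef, hf0, hg0]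
  have hG' : HasFDerivAt G (ContinuousLinearMap.id ℂ (Cn1 n)) 0 := by
    have h1 := (hasFDerivAt_fst (𝕜 := ℂ) (p := (0 : Cn1 n))).add
      (hasFDerivAt_zero_of_isBigO (𝕜 := ℂ) hfO)
    have h2 := (hasFDerivAt_snd (𝕜 := ℂ) (p := (0 : Cn1 n))).add
      (hasFDerivAt_zero_of_isBigO (𝕜 := ℂ) hgO)
    have h3 := h1.prodMk h2
    refine h3.congr_fderiv ?_
    ext x <;> simp
  have hX := lift_isBigO hN
  have hXt : Tendsto (fun y => lift y (N y)) (𝓝 0) (𝓝 0) :=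
    tendsto_zero_of_isBigO_pow (k := 1) one_ne_zero (by simpa using hX)
  have hfX : (fun y => f (lift y (N y))) =O[𝓝 0] fun y => ‖y‖ ^ 2 :=
    (hfO.comp_tendsto hXt).trans (hX.norm_left.pow 2)
  have hgX : (fun y => g (lift y (N y))) =O[𝓝 0] fun y => ‖y‖ ^ 2 :=
    (hgO.comp_tendsto hXt).trans (hX.norm_left.pow 2)
  set δ : Yn n → Yn n := fun y => (f (lift y (N y)), (g (lift y (N y))).re) with hδ
  have hδO : δ =O[𝓝 0] fun y => ‖y‖ ^ 2 := by
    refine hfX.prod_left (IsBigO.trans ?_ hgX)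
    exact IsBigO.of_bound 1 (Eventually.of_forall fun y => by
      rw [one_mul]; exact Complex.abs_re_le_norm _)
  have hyδ : (fun y => y + δ y) =O[𝓝 0] fun y : Yn n => ‖y‖ ^ 1 := by
    refine IsBigO.add ?_ (hδO.trans (isBigO_pow_of_le (by norm_num)))
    simpa using (isBigO_refl (fun y : Yn n => y) (𝓝 0)).norm_right
  have hyt : Tendsto (fun y => y + δ y) (𝓝 0) (𝓝 0) := tendsto_zero_of_isBigO_pow one_ne_zero hyδ
  have hE := (hφ.comp_tendsto hyt).trans ((hyδ.norm_left.pow (d + 1)).congr_right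
    (g₂ := fun y => ‖y‖ ^ (d + 1)) fun y => by simp)
  obtain ⟨φ', h1, h2⟩ := h.change hφ2 hG hG0 hG' (tendsto_zero_of_isBigO_pow two_ne_zero hN)
    (k := d + 1) (by
      -- The residual is the expression of `hK`, minus the change of the degree `d` term from `y` to
      -- `y + δ y`, minus the remainder of `φ` at `y + δ y`. The term `|z + f|_ℓ²` is expanded
      -- exactly by polarization, since its cross term is not negligible.
      refine ((hK.sub (multilinear_diag_sub_isBigO (by omega) m hδO)).sub hE).congr_left fun y => ?_
      have e1 : ((G (lift y (N y))).1, (G (lift y (N y))).2.re) = y + δ y := by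
        rfl
      have e2 : (G (lift y (N y))).2.im = N y + (g (lift y (N y))).im := by
        simp [hGdef, lift]
      have e3 : qf ℓ (y + δ y).1 = qf ℓ y.1 + 2 * hermRe ℓ (f (lift y (N y))) y.1
          + qf ℓ (f (lift y (N y))) := qf_add ℓ _ _
      rw [e1, e2]
      simp only [Function.comp_apply, e3]
      ring)
  exact ⟨_, φ', h1, h2⟩

end Charts

/-! ### Homogeneous polynomials -/

section Polynomials

variable {n : ℕ}

/-- Properties of a holomorphic homogeneous polynomial of degree `k` on `ℂⁿ × ℂ`. -/
structure IsHolPoly (k : ℕ) (g : Cn1 n → ℂ) : Prop where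
  contDiff : ContDiff ℂ ∞ g
  smul : ∀ (c : ℂ) x, g (c • x) = c ^ k * g x
  -- The Lipschitz estimate carries `r` on the left to avoid the exponent `k - 1`, which would be
  -- wrong for constants.
  bound : ∃ C : ℝ, 0 ≤ C ∧ ∀ (r : ℝ) (x x' : Cn1 n), ‖x‖ ≤ r → ‖x'‖ ≤ r →
    ‖g x‖ ≤ C * r ^ k ∧ r * ‖g x - g x'‖ ≤ C * r ^ k * ‖x - x'‖

theorem IsHolPoly.zero (k : ℕ) : IsHolPoly k (fun _ : Cn1 n => (0 : ℂ)) :=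
  ⟨contDiff_const, by simp, 0, le_rfl, by simp⟩

theorem IsHolPoly.const (a : ℂ) : IsHolPoly 0 (fun _ : Cn1 n => a) :=
  ⟨contDiff_const, by simp, ‖a‖, norm_nonneg a, fun r x x' _ _ => by
    simpa using mul_nonneg (norm_nonneg a) (norm_nonneg _)⟩

theorem IsHolPoly.fst (j : Fin n) : IsHolPoly 1 (fun x : Cn1 n => x.1 j) := by
  refine ⟨by fun_prop, by simp, 1, zero_le_one, fun r x x' hx hx' => ?_⟩
  have h1 : ∀ x : Cn1 n, ‖x.1 j‖ ≤ ‖x‖ := fun x => (norm_le_pi_norm x.1 j).trans (norm_fst_le x)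
  refine ⟨by simpa using (h1 x).trans hx, ?_⟩
  have := h1 (x - x')
  simp only [pow_one, one_mul]
  exact mul_le_mul_of_nonneg_left this ((norm_nonneg x).trans hx)

theorem IsHolPoly.snd : IsHolPoly 1 (fun x : Cn1 n => x.2) := by
  refine ⟨by fun_prop, by simp, 1, zero_le_one, fun r x x' hx hx' => ?_⟩
  refine ⟨by simpa using (norm_snd_le x).trans hx, ?_⟩
  have := norm_snd_le (x - x')
  simp only [pow_one, one_mul]
  exact mul_le_mul_of_nonneg_left this ((norm_nonneg x).trans hx)

theorem IsHolPoly.add {k : ℕ} {g h : Cn1 n → ℂ} (hg : IsHolPoly k g) (hh : IsHolPoly k h) :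
    IsHolPoly k (fun x => g x + h x) := by
  obtain ⟨C, hC, hgb⟩ := hg.bound
  obtain ⟨C', hC', hhb⟩ := hh.bound
  refine ⟨hg.contDiff.add hh.contDiff, fun c x => by rw [hg.smul, hh.smul]; ring, C + C',
    add_nonneg hC hC', fun r x x' hx hx' => ⟨?_, ?_⟩⟩
  · refine (norm_add_le _ _).trans ?_
    linarith [(hgb r x x' hx hx').1, (hhb r x x' hx hx').1]
  · have h1 : ‖g x + h x - (g x' + h x')‖ ≤ ‖g x - g x'‖ + ‖h x - h x'‖ := by
      rw [add_sub_add_comm]; exact norm_add_le _ _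
    have h2 := mul_le_mul_of_nonneg_left h1 ((norm_nonneg x).trans hx)
    linarith [(hgb r x x' hx hx').2, (hhb r x x' hx hx').2]

theorem IsHolPoly.mul {k l : ℕ} {g h : Cn1 n → ℂ} (hg : IsHolPoly k g) (hh : IsHolPoly l h) :
    IsHolPoly (k + l) (fun x => g x * h x) := by
  obtain ⟨C, hC, hgb⟩ := hg.bound
  obtain ⟨C', hC', hhb⟩ := hh.bound
  refine ⟨hg.contDiff.mul hh.contDiff, fun c x => by rw [hg.smul, hh.smul]; ring, 2 * (C * C'),
    by positivity, fun r x x' hx hx' => ?_⟩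
  have hr : 0 ≤ r := (norm_nonneg x).trans hx
  obtain ⟨a1, a2⟩ := hgb r x x' hx hx'
  obtain ⟨b1, b2⟩ := hhb r x x' hx hx'
  have a1' := (hgb r x' x hx' hx).1
  constructor
  · rw [norm_mul, pow_add]
    have := mul_le_mul a1 b1 (norm_nonneg _) (by positivity)
    have h0 : 0 ≤ C * C' * (r ^ k * r ^ l) := by positivity
    linarith
  · have h1 : ‖g x * h x - g x' * h x'‖ ≤ ‖g x - g x'‖ * ‖h x‖ + ‖g x'‖ * ‖h x - h x'‖ := by
      have : g x * h x - g x' * h x' = (g x - g x') * h x + g x' * (h x - h x') := by ring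
      rw [this]
      refine (norm_add_le _ _).trans ?_
      rw [norm_mul, norm_mul]
    calc r * ‖g x * h x - g x' * h x'‖
        ≤ r * (‖g x - g x'‖ * ‖h x‖ + ‖g x'‖ * ‖h x - h x'‖) := by gcongr
      _ = (r * ‖g x - g x'‖) * ‖h x‖ + ‖g x'‖ * (r * ‖h x - h x'‖) := by ring
      _ ≤ (C * r ^ k * ‖x - x'‖) * (C' * r ^ l) + (C * r ^ k) * (C' * r ^ l * ‖x - x'‖) := by
        gcongr
      _ = _ := by rw [pow_add]; ring

theorem IsHolPoly.const_mul {k : ℕ} {g : Cn1 n → ℂ} (a : ℂ) (hg : IsHolPoly k g) :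
    IsHolPoly k (fun x => a * g x) := by
  simpa using (IsHolPoly.const a).mul hg

theorem IsHolPoly.sum {k : ℕ} {ι : Type*} (s : Finset ι) {g : ι → Cn1 n → ℂ}
    (hg : ∀ i, IsHolPoly k (g i)) : IsHolPoly k (fun x => ∑ i ∈ s, g i x) := by
  classical
  induction s using Finset.induction_on with
  | empty => simpa using IsHolPoly.zero k
  | insert i s hi ih =>
    simp only [Finset.sum_insert hi]
    exact (hg i).add ih

theorem IsHolPoly.isBigO {k : ℕ} {g : Cn1 n → ℂ} (hg : IsHolPoly k g) :
    g =O[𝓝 0] fun x => ‖x‖ ^ k := by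
  obtain ⟨C, hC, hb⟩ := hg.bound
  refine IsBigO.of_bound C (Eventually.of_forall fun x => ?_)
  rw [norm_pow, norm_norm]
  exact (hb ‖x‖ x x le_rfl le_rfl).1

/-- Replacing `u + iN` by `u` costs one degree for the derivative and gains two from `N`. Hence in
each step the polynomials may be evaluated at real `w = u`. -/
theorem IsHolPoly.lift_sub_isBigO {k : ℕ} {g : Cn1 n → ℂ} (hg : IsHolPoly k g) {N : Yn n → ℝ}
    (hN : N =O[𝓝 0] fun y => ‖y‖ ^ 2) :
    (fun y => g (lift y (N y)) - g (lift y 0)) =O[𝓝 0] fun y => ‖y‖ ^ (k + 1) := by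
  obtain ⟨C, hC, hb⟩ := hg.bound
  obtain ⟨A, hA⟩ := hN.bound
  refine IsBigO.of_bound (C * (1 + |A|) ^ k * |A|) ?_
  filter_upwards [hA, Metric.ball_mem_nhds (0 : Yn n) one_pos] with y hy hy1
  rw [mem_ball_zero_iff] at hy1
  rw [norm_pow, norm_norm] at hy ⊢
  have hy' : |N y| ≤ |A| * ‖y‖ ^ 2 := hy.trans (by gcongr; exact le_abs_self A)
  rcases eq_or_ne y 0 with rfl | hy0
  · have : N 0 = 0 := by simpa using hy'
    simp [this]
  have hpos : 0 < ‖y‖ := norm_pos_iff.2 hy0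
  have h1 : ‖lift y (N y)‖ ≤ (1 + |A|) * ‖y‖ := by
    refine (norm_lift_le _ _).trans ?_
    have : |A| * ‖y‖ ^ 2 ≤ |A| * ‖y‖ := by
      gcongr
      nlinarith
    linarith
  have h2 : ‖lift y 0‖ ≤ (1 + |A|) * ‖y‖ := by
    refine (norm_lift_le _ _).trans ?_
    rw [abs_zero, add_zero]
    nlinarith [abs_nonneg A]
  have h3 := (hb _ _ _ h1 h2).2
  rw [norm_lift_sub_lift, sub_zero] at h3
  refine le_of_mul_le_mul_left ?_ hpos
  calc ‖y‖ * ‖g (lift y (N y)) - g (lift y 0)‖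
      ≤ ((1 + |A|) * ‖y‖) * ‖g (lift y (N y)) - g (lift y 0)‖ := by
        gcongr
        nlinarith [abs_nonneg A]
    _ ≤ C * ((1 + |A|) * ‖y‖) ^ k * |N y| := h3
    _ ≤ C * ((1 + |A|) * ‖y‖) ^ k * (|A| * ‖y‖ ^ 2) := by gcongr
    _ = _ := by rw [mul_pow]; ring

/-- The monomial `z_{K₁} ⋯ z_{K_r} w^c`. -/
def mon (K : List (Fin n)) (c : ℕ) (x : Cn1 n) : ℂ := (K.map x.1).prod * x.2 ^ c

theorem isHolPoly_mon (K : List (Fin n)) (c : ℕ) : IsHolPoly (K.length + c) (mon K c) := by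
  refine IsHolPoly.mul ?_ ?_
  · induction K with
    | nil => simpa using IsHolPoly.const 1
    | cons j K ih =>
      simp only [List.map_cons, List.prod_cons, List.length_cons]
      rw [add_comm K.length]
      exact (IsHolPoly.fst j).mul ih
  · induction c with
    | zero => simpa using IsHolPoly.const 1
    | succ c ih =>
      simp only [pow_succ]
      exact ih.mul IsHolPoly.snd

/-- `Re Q = Im g(z, u) + Re ∑ f_j(z, u) z̄_j + Re s(z, z̄)` with holomorphic homogeneous
polynomials `g` of degree `e + 1` and `f_j` of degree `e`; the quartic term `s` is absent in
degrees below `4`, and the `f_j` do not depend on `w` in degree `2`. -/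
def HasSplitting (e : ℕ) (Q : Yn n → ℂ) : Prop :=
  ∃ (g : Cn1 n → ℂ) (f : Fin n → Cn1 n → ℂ) (s : Fin n → Fin n → Fin n → Fin n → ℂ),
    IsHolPoly (e + 1) g ∧ (∀ j, IsHolPoly e (f j)) ∧ (e ≤ 2 → s = 0) ∧
    (e = 1 → ∀ j z w, f j (z, w) = f j (z, 0)) ∧
    ∀ y, (Q y).re = (g (lift y 0)).im + (∑ j, f j (lift y 0) * conj (y.1 j)).re
      + (quartic s y.1).re

/-! ### Splitting real polynomials of degree at most four. -/

theorem quartic_zero (z : Fin n → ℂ) : quartic 0 z = 0 := by simp [quartic]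

theorem quartic_add (s t : Fin n → Fin n → Fin n → Fin n → ℂ) (z : Fin n → ℂ) :
    quartic (s + t) z = quartic s z + quartic t z := by
  simp [quartic, add_mul, Finset.sum_add_distrib]

theorem HasSplitting.add {e : ℕ} {Q Q' : Yn n → ℂ} (h : HasSplitting e Q)
    (h' : HasSplitting e Q') : HasSplitting e (Q + Q') := by
  obtain ⟨g, f, s, hg, hf, hs, hw, h⟩ := h
  obtain ⟨g', f', s', hg', hf', hs', hw', h'⟩ := h'
  refine ⟨fun x => g x + g' x, fun j x => f j x + f' j x, s + s', hg.add hg',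
    fun j => (hf j).add (hf' j), fun he => by rw [hs he, hs' he, add_zero],
    fun he j z w => congrArg₂ _ (hw he j z w) (hw' he j z w), fun y => ?_⟩
  rw [Pi.add_apply, Complex.add_re, h, h', quartic_add]
  simp only [add_mul, Finset.sum_add_distrib, Complex.add_re, Complex.add_im]
  ring

theorem HasSplitting.congr {e : ℕ} {Q Q' : Yn n → ℂ} (h : HasSplitting e Q)
    (hQ : ∀ y, (Q' y).re = (Q y).re) : HasSplitting e Q' := by
  obtain ⟨g, f, s, hg, hf, hs, hw, h⟩ := h
  exact ⟨g, f, s, hg, hf, hs, hw, fun y => by rw [hQ, h]⟩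

theorem hasSplitting_hol {e : ℕ} (a : ℂ) (K : List (Fin n)) (c : ℕ) (hK : K.length + c = e + 1) :
    HasSplitting e (fun y : Yn n => a * ((K.map y.1).prod * (y.2 : ℂ) ^ c)) := by
  refine ⟨fun x => Complex.I * a * mon K c x, fun _ _ => 0, 0,
    (hK ▸ isHolPoly_mon K c).const_mul _, fun _ => IsHolPoly.zero e, fun _ => rfl,
    fun _ _ _ _ => rfl, fun y => ?_⟩
  have : mon K c (lift y 0) = (K.map y.1).prod * (y.2 : ℂ) ^ c := rfl
  simp only [quartic_zero, mul_assoc, Complex.I_mul_im, this]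
  simp

theorem hasSplitting_linear {e : ℕ} (a : ℂ) (K : List (Fin n)) (β : Fin n) (c : ℕ)
    (hK : K.length + c = e) (hK0 : K ≠ []) :
    HasSplitting e (fun y : Yn n => a * ((K.map y.1).prod * conj (y.1 β) * (y.2 : ℂ) ^ c)) := by
  refine ⟨fun _ => 0, fun j x => if j = β then a * mon K c x else 0, 0, IsHolPoly.zero _, fun j => ?_,
    fun _ => rfl, fun he j z w => ?_, fun y => ?_⟩
  · by_cases hj : j = β
    · simp only [hj, if_true]
      exact (hK ▸ isHolPoly_mon K c).const_mul _
    · simp only [hj, if_false]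
      exact IsHolPoly.zero _
  · have hc : c = 0 := by
      have := List.length_pos_of_ne_nil hK0
      omega
    simp [mon, hc]
  · have : mon K c (lift y 0) = (K.map y.1).prod * (y.2 : ℂ) ^ c := rfl
    simp only [ite_mul, zero_mul, Finset.sum_ite_eq', Finset.mem_univ, if_true, quartic_zero, this,
      Complex.zero_im, Complex.zero_re]
    rw [zero_add, add_zero]
    congr 1
    ring

/-- Only the real part matters, so a monomial may be conjugated. If `K` or `L` is empty it becomes
holomorphic; if one of them is a singleton it becomes linear in `z̄`. Otherwise both have length at
least 2, and total degree at most 4 forces type `(2, 2)` without `u`. This is where `e ≤ 3` enters.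
-/
theorem hasSplitting_monomial {e : ℕ} (he : e ≤ 3) (a : ℂ) (K L : List (Fin n)) (c : ℕ)
    (hlen : K.length + L.length + c = e + 1) :
    HasSplitting e (fun y : Yn n => a * ((K.map y.1).prod *
      (L.map fun j => conj (y.1 j)).prod * (y.2 : ℂ) ^ c)) := by
  have hconj : ∀ (L : List (Fin n)) (y : Yn n),
      conj ((L.map y.1).prod) = (L.map fun j => conj (y.1 j)).prod := by
    intro L y
    rw [map_list_prod, List.map_map]
    rfl
  match K, L with
  | K, [] =>
    refine (hasSplitting_hol a K c (by simpa using hlen)).congr fun y => ?_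
    simp
  | [], L =>
    refine (hasSplitting_hol (conj a) L c (by simpa using hlen)).congr fun y => ?_
    rw [← Complex.conj_re]
    simp [← hconj]
  | α :: K, [β] =>
    refine (hasSplitting_linear a (α :: K) β c (by simp at hlen ⊢; omega) (by simp)).congr
      fun y => ?_
    simp
  | [α], β :: L =>
    refine (hasSplitting_linear (conj a) (β :: L) α c (by simp at hlen ⊢; omega) (by simp)).congr
      fun y => ?_
    rw [← Complex.conj_re]
    simp only [← hconj]
    congr 1
    simp only [map_mul, map_pow, Complex.conj_conj, Complex.conj_ofReal, List.map_cons,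
      List.map_nil, List.prod_cons, List.prod_nil, mul_one]
    ring
  | [α, γ], [β, δ] =>
    refine ⟨fun _ => 0, fun _ _ => 0, fun α' β' γ' δ' =>
      if α' = α then if β' = β then if γ' = γ then if δ' = δ then a else 0 else 0 else 0 else 0,
      IsHolPoly.zero _, fun _ => IsHolPoly.zero _, fun h => ?_, fun _ _ _ _ => rfl, fun y => ?_⟩
    · simp at hlen
      omega
    · have hc : c = 0 := by
        simp at hlen
        omega
      simp [quartic, hc, ite_mul]
      ring_nf
  | _ :: _ :: _ :: _, _ :: _ :: _ => simp at hlen; omega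
  | _ :: _ :: _, _ :: _ :: _ :: _ => simp at hlen; omega

/-- The coordinate functions `z_j`, `z̄_j` and `u`. -/
def letters (n : ℕ) : Set (Yn n → ℂ) :=
  (Set.range fun j y => y.1 j) ∪ (Set.range fun j y => conj (y.1 j)) ∪ {fun y => (y.2 : ℂ)}

theorem exists_lists_of_mem_letters_pow {d : ℕ} {Q : Yn n → ℂ} (hQ : Q ∈ letters n ^ d) :
    ∃ (K L : List (Fin n)) (c : ℕ), K.length + L.length + c = d ∧
      ∀ y, Q y = (K.map y.1).prod * (L.map fun j => conj (y.1 j)).prod * (y.2 : ℂ) ^ c := by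
  induction d generalizing Q with
  | zero =>
    rw [pow_zero, Set.mem_one] at hQ
    exact ⟨[], [], 0, rfl, fun y => by simp [hQ]⟩
  | succ d ih =>
    rw [pow_succ, Set.mem_mul] at hQ
    obtain ⟨Q', hQ', l, hl, rfl⟩ := hQ
    obtain ⟨K, L, c, hlen, h⟩ := ih hQ'
    rcases hl with (⟨j, rfl⟩ | ⟨j, rfl⟩) | rfl
    · exact ⟨j :: K, L, c, by simp; omega, fun y => by simp [h]; ring⟩
    · exact ⟨K, j :: L, c, by simp; omega, fun y => by simp [h]; ring⟩
    · exact ⟨K, L, c + 1, by omega, fun y => by simp [h]; ring⟩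

theorem functional_mem_span_letters (lam : Yn n →ₗ[ℝ] ℝ) :
    (fun y => (lam y : ℂ)) ∈ Submodule.span ℂ (letters n) := by
  have hy : ∀ y : Yn n, y = (∑ j, ((y.1 j).re • ((Pi.single j 1, 0) : Yn n)
      + (y.1 j).im • ((Pi.single j Complex.I, 0) : Yn n))) + y.2 • ((0, 1) : Yn n) := by
    intro y
    refine Prod.ext ?_ ?_
    · simp only [Prod.fst_add, Prod.fst_sum, Prod.smul_fst, smul_zero, add_zero]
      funext k
      rw [Finset.sum_apply, Finset.sum_eq_single k]
      · simp
      · intro j _ hj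
        simp [Pi.single_eq_of_ne (Ne.symm hj)]
      · simp
    · simp [Prod.snd_sum]
  have hz : ∀ j, (fun y : Yn n => y.1 j) ∈ Submodule.span ℂ (letters n) := fun j =>
    Submodule.subset_span (Or.inl (Or.inl ⟨j, rfl⟩))
  have hzb : ∀ j, (fun y : Yn n => conj (y.1 j)) ∈ Submodule.span ℂ (letters n) := fun j =>
    Submodule.subset_span (Or.inl (Or.inr ⟨j, rfl⟩))
  have hu : (fun y : Yn n => (y.2 : ℂ)) ∈ Submodule.span ℂ (letters n) :=
    Submodule.subset_span (Or.inr rfl)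
  have heq : (fun y => (lam y : ℂ)) = (∑ j, (((lam (Pi.single j 1, 0) : ℂ) / 2
        - Complex.I * (lam (Pi.single j Complex.I, 0) : ℂ) / 2) • (fun y : Yn n => y.1 j)
      + ((lam (Pi.single j 1, 0) : ℂ) / 2 + Complex.I * (lam (Pi.single j Complex.I, 0) : ℂ) / 2) •
        (fun y : Yn n => conj (y.1 j)))) + (lam (0, 1) : ℂ) • (fun y : Yn n => (y.2 : ℂ)) := by
    funext y
    conv_lhs => rw [hy y]
    rw [map_add, map_sum, map_smul]
    simp only [map_add, map_smul, smul_eq_mul, Pi.add_apply, Finset.sum_apply, Pi.smul_apply]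
    push_cast
    congr 1
    · refine Finset.sum_congr rfl fun j _ => ?_
      rw [Complex.re_eq_add_conj, Complex.im_eq_sub_conj]
      field_simp
      linear_combination (y.1 j * lam (Pi.single j Complex.I, 0)
        - conj (y.1 j) * lam (Pi.single j Complex.I, 0)) * Complex.I_sq
    · ring
  rw [heq]
  refine add_mem (sum_mem fun j _ => add_mem ?_ ?_) (Submodule.smul_mem _ _ hu)
  · exact Submodule.smul_mem _ _ (hz j)
  · exact Submodule.smul_mem _ _ (hzb j)

theorem prod_mem_pow {A : Type*} [CommSemiring A] [Algebra ℂ A] (S : Submodule ℂ A) {d : ℕ}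
    {F : Fin d → A} (hF : ∀ k, F k ∈ S) : ∏ k, F k ∈ S ^ d := by
  induction d with
  | zero => exact Submodule.mem_one.2 ⟨1, by simp⟩
  | succ d ih =>
    rw [Fin.prod_univ_castSucc, pow_succ]
    exact Submodule.mul_mem_mul (ih fun k => hF _) (hF _)

/-- Expanded in a real basis, the diagonal of `m` is a sum of products of `d` linear functionals,
each a complex combination of `z_j`, `z̄_j` and `u`. -/
theorem diag_mem_span_letters_pow {d : ℕ}
    (m : ContinuousMultilinearMap ℝ (fun _ : Fin d => Yn n) ℝ) :
    (fun y => ((m fun _ => y : ℝ) : ℂ)) ∈ Submodule.span ℂ (letters n) ^ d := by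
  let b := Module.finBasis ℝ (Yn n)
  have heq : (fun y => ((m fun _ => y : ℝ) : ℂ)) = ∑ κ : Fin d → Fin (Module.finrank ℝ (Yn n)),
      ((m fun k => b (κ k) : ℝ) : ℂ) • ∏ k, (fun y => ((b.coord (κ k) y : ℝ) : ℂ)) := by
    funext y
    have h1 : (m fun _ => y) = m fun _ => ∑ i, b.coord i y • b i := by
      congr 1
      funext _
      exact (b.sum_repr y).symm
    rw [h1]
    have h2 := m.toMultilinearMap.map_sum (fun (_ : Fin d) i => b.coord i y • b i)
    change (m.toMultilinearMap _ : ℝ) = _ at h2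
    change ((m.toMultilinearMap _ : ℝ) : ℂ) = _
    rw [h2, Complex.ofReal_sum, Finset.sum_apply]
    refine Finset.sum_congr rfl fun κ _ => ?_
    rw [MultilinearMap.map_smul_univ]
    simp only [smul_eq_mul, Complex.ofReal_mul, Complex.ofReal_prod, Pi.smul_apply,
      Finset.prod_apply]
    rw [mul_comm]
    rfl
  rw [heq]
  exact sum_mem fun κ _ => Submodule.smul_mem _ _
    (prod_mem_pow _ fun k => functional_mem_span_letters _)

theorem hasSplitting_diag {e : ℕ} (he : e ≤ 3)
    (m : ContinuousMultilinearMap ℝ (fun _ : Fin (e + 1) => Yn n) ℝ) :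
    HasSplitting e (fun y => ((m fun _ => y : ℝ) : ℂ)) := by
  have hmem := diag_mem_span_letters_pow m
  rw [Submodule.span_pow] at hmem
  -- A splitting records only `Re Q` and does not obviously pass to complex multiples, so the
  -- induction carries all multiples `a • Q` at once.
  have key : ∀ Q ∈ Submodule.span ℂ (letters n ^ (e + 1)), ∀ a : ℂ, HasSplitting e (a • Q) := by
    intro Q hQ
    induction hQ using Submodule.span_induction with
    | mem Q hQ =>
      intro a
      obtain ⟨K, L, c, hlen, h⟩ := exists_lists_of_mem_letters_pow hQ
      exact (hasSplitting_monomial he a K L c hlen).congr fun y => by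
        rw [Pi.smul_apply, smul_eq_mul, h]
    | zero =>
      intro a
      exact ⟨fun _ => 0, fun _ _ => 0, 0, IsHolPoly.zero _, fun _ => IsHolPoly.zero _,
        fun _ => rfl, fun _ _ _ _ => rfl, fun y => by simp [quartic_zero]⟩
    | add Q Q' _ _ h h' =>
      intro a
      rw [smul_add]
      exact (h a).add (h' a)
    | smul c Q _ h =>
      intro a
      rw [smul_smul]
      exact h _
  simpa using key _ hmem 1

end Polynomials

/-! ### Trace decomposition of quartic forms -/

section Tensors

variable {n : ℕ}

/-- The Hermitian form `∑ H_{αβ̄} z_α z̄_β`. -/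
def hermForm (H : Fin n → Fin n → ℂ) (z : Fin n → ℂ) : ℂ := ∑ α, ∑ β, H α β * (z α * conj (z β))

theorem quartic_smul (c : ℂ) (s : Fin n → Fin n → Fin n → Fin n → ℂ) (z : Fin n → ℂ) :
    quartic (fun α β γ δ => c * s α β γ δ) z = c * quartic s z := by
  simp only [quartic, Finset.mul_sum, mul_assoc]

theorem quartic_swap_left (s : Fin n → Fin n → Fin n → Fin n → ℂ) (z : Fin n → ℂ) :
    quartic (fun α β γ δ => s γ β α δ) z = quartic s z := by
  unfold quartic
  calc _ = ∑ α, ∑ γ, ∑ β, ∑ δ, s γ β α δ * (z α * conj (z β) * z γ * conj (z δ)) :=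
        Finset.sum_congr rfl fun α _ => Finset.sum_comm
    _ = ∑ γ, ∑ α, ∑ β, ∑ δ, s γ β α δ * (z α * conj (z β) * z γ * conj (z δ)) := Finset.sum_comm
    _ = ∑ γ, ∑ β, ∑ α, ∑ δ, s γ β α δ * (z α * conj (z β) * z γ * conj (z δ)) :=
        Finset.sum_congr rfl fun α _ => Finset.sum_comm
    _ = _ := by
        refine Finset.sum_congr rfl fun γ _ => Finset.sum_congr rfl fun β _ =>
          Finset.sum_congr rfl fun α _ => Finset.sum_congr rfl fun δ _ => ?_
        ring

theorem conj_quartic (s : Fin n → Fin n → Fin n → Fin n → ℂ) (z : Fin n → ℂ) :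
    conj (quartic s z) = quartic (fun α β γ δ => conj (s β α δ γ)) z := by
  unfold quartic
  simp only [map_sum, map_mul, Complex.conj_conj]
  rw [Finset.sum_comm]
  refine Finset.sum_congr rfl fun β _ => Finset.sum_congr rfl fun α _ => ?_
  rw [Finset.sum_comm]
  refine Finset.sum_congr rfl fun δ _ => Finset.sum_congr rfl fun γ _ => ?_
  ring

theorem quartic_swap_right (s : Fin n → Fin n → Fin n → Fin n → ℂ) (z : Fin n → ℂ) :
    quartic (fun α β γ δ => s α δ γ β) z = quartic s z := by
  apply (starRingEnd ℂ).injective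
  rw [conj_quartic, conj_quartic]
  exact quartic_swap_left (fun α β γ δ => conj (s β α δ γ)) z

/-- Symmetrization in the holomorphic and in the antiholomorphic indices. -/
def symmetrize (s : Fin n → Fin n → Fin n → Fin n → ℂ) (α β γ δ : Fin n) : ℂ :=
  1 / 4 * (s α β γ δ + s γ β α δ + s α δ γ β + s γ δ α β)

theorem quartic_symmetrize (s : Fin n → Fin n → Fin n → Fin n → ℂ) (z : Fin n → ℂ) :
    quartic (symmetrize s) z = quartic s z := by
  have h1 : symmetrize s = fun α β γ δ => 1 / 4 * ((s + (fun α β γ δ => s γ β α δ)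
      + (fun α β γ δ => s α δ γ β) + fun α β γ δ => s γ δ α β) α β γ δ) := rfl
  rw [h1, quartic_smul, quartic_add, quartic_add, quartic_add, quartic_swap_left,
    quartic_swap_right, quartic_swap_left (fun α β γ δ => s α δ γ β), quartic_swap_right]
  ring

theorem normSqL_mul_hermForm (ℓ : ℕ) (H : Fin n → Fin n → ℂ) (z : Fin n → ℂ) :
    normSqL ℓ z * hermForm H z = quartic (fun α β γ δ => gInv ℓ α β * H γ δ) z := by
  unfold normSqL hermForm quartic gInv
  rw [Finset.sum_mul]
  refine Finset.sum_congr rfl fun α _ => ?_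
  refine Eq.trans ?_ (Finset.sum_eq_single α (fun β _ hβ => ?_) (by simp)).symm
  · simp only [if_true, Finset.mul_sum]
    refine Finset.sum_congr rfl fun γ _ => Finset.sum_congr rfl fun δ _ => ?_
    ring
  · simp [Ne.symm hβ]

theorem sgn_mul_self (ℓ : ℕ) (j : Fin n) : sgn ℓ j * sgn ℓ j = 1 := by
  unfold sgn; split_ifs <;> simp

theorem conj_sgn (ℓ : ℕ) (j : Fin n) : conj (sgn ℓ j) = sgn ℓ j := by
  unfold sgn; split_ifs <;> simp

theorem trace_eq_sum (ℓ : ℕ) (s : Fin n → Fin n → Fin n → Fin n → ℂ) (γ δ : Fin n) :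
    ∑ α, ∑ β, s α β γ δ * gInv ℓ β α = ∑ α, sgn ℓ α * s α α γ δ := by
  refine Finset.sum_congr rfl fun α _ => ?_
  rw [Finset.sum_eq_single α]
  · simp [gInv, mul_comm]
  · intro β _ hβ
    simp [gInv, hβ]
  · simp

theorem conj_gInv (ℓ : ℕ) (α β : Fin n) : conj (gInv ℓ α β) = gInv ℓ β α := by
  unfold gInv
  by_cases h : α = β
  · subst h
    simp [conj_sgn]
  · simp [h, Ne.symm h]

/-- Of the four symmetrized terms, one contracts to `n H`, two mixed ones contract to `H` each, and
the last gives `g₀` times the trace of `H`. -/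
theorem trace_symmetrize_gInv (ℓ : ℕ) (H : Fin n → Fin n → ℂ) (γ δ : Fin n) :
    ∑ α, sgn ℓ α * symmetrize (fun α β γ δ => gInv ℓ α β * H γ δ) α α γ δ
      = 1 / 4 * ((n + 2) * H γ δ + gInv ℓ γ δ * ∑ α, sgn ℓ α * H α α) := by
  have h1 : ∀ α, sgn ℓ α * symmetrize (fun α β γ δ => gInv ℓ α β * H γ δ) α α γ δ =
      1 / 4 * (H γ δ + (if γ = α then H α δ else 0) + (if α = δ then H γ α else 0)
        + gInv ℓ γ δ * (sgn ℓ α * H α α)) := by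
    intro α
    have e1 : sgn ℓ α * gInv ℓ α α = 1 := by simp [gInv, sgn_mul_self]
    have e2 : sgn ℓ α * gInv ℓ γ α = if γ = α then 1 else 0 := by
      unfold gInv
      split_ifs with h
      · rw [h, sgn_mul_self]
      · simp
    have e3 : sgn ℓ α * gInv ℓ α δ = if α = δ then 1 else 0 := by
      unfold gInv
      split_ifs with h
      · rw [sgn_mul_self]
      · simp
    have e2' : (if γ = α then H α δ else 0) = (if γ = α then 1 else 0) * H α δ := by simp
    have e3' : (if α = δ then H γ α else 0) = (if α = δ then 1 else 0) * H γ α := by simp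
    rw [e2', e3', ← e2, ← e3]
    unfold symmetrize
    linear_combination 1 / 4 * H γ δ * e1
  simp only [h1, ← Finset.mul_sum, Finset.sum_add_distrib]
  simp
  ring

theorem exists_trace_decomposition (ℓ : ℕ) (s₀ : Fin n → Fin n → Fin n → Fin n → ℂ) :
    ∃ (s : Fin n → Fin n → Fin n → Fin n → ℂ) (H : Fin n → Fin n → ℂ), IsChernMoserTensor ℓ s ∧
      (∀ α β, conj (H α β) = H β α) ∧
      ∀ z, ((quartic s₀ z).re : ℂ) - 2 * (normSqL ℓ z * hermForm H z)
        = -(1 / 4) * quartic s z := by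
  -- Coefficients of the real part of `quartic s₀`, with all the required symmetries.
  set s₁ := symmetrize fun α β γ δ => 1 / 2 * (s₀ α β γ δ + conj (s₀ β α δ γ)) with hs₁
  have hs₁q : ∀ z, quartic s₁ z = ((quartic s₀ z).re : ℂ) := by
    intro z
    rw [hs₁, quartic_symmetrize, quartic_smul, Complex.re_eq_add_conj, conj_quartic, ← quartic_add]
    simp only [Pi.add_def]
    ring
  have hs₁c : ∀ α β γ δ, conj (s₁ α β γ δ) = s₁ β α δ γ := by
    intro α β γ δ
    simp only [hs₁, symmetrize, map_mul, map_add, map_div₀, map_one, map_ofNat, Complex.conj_conj]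
    ring
  set t : Fin n → Fin n → ℂ := fun γ δ => ∑ α, sgn ℓ α * s₁ α α γ δ with ht
  set τ : ℂ := ∑ α, sgn ℓ α * t α α with hτ
  have htc : ∀ γ δ, conj (t γ δ) = t δ γ := by
    intro γ δ
    simp only [ht, map_sum, map_mul, hs₁c, conj_sgn]
  have hτc : conj τ = τ := by
    simp only [hτ, map_sum, map_mul, htc, conj_sgn]
  -- Trace-freeness of `s₁ - 2 S` reads `t = ((n + 2) H + g₀ tr H) / 2`. Taking the trace once more
  -- gives `tr H = τ / (n + 1)`, and solving for `H` gives this formula.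
  set H : Fin n → Fin n → ℂ := fun γ δ => 2 / (n + 2) * (t γ δ - gInv ℓ γ δ * τ / (2 * n + 2))
    with hH
  have hHc : ∀ γ δ, conj (H γ δ) = H δ γ := by
    intro γ δ
    simp only [hH, map_mul, map_sub, map_div₀, htc, hτc, conj_gInv, map_add, map_natCast,
      map_ofNat]
  have hn2 : (n : ℂ) + 2 ≠ 0 := by exact_mod_cast (by omega : n + 2 ≠ 0)
  have hn1 : (n : ℂ) + 1 ≠ 0 := by exact_mod_cast (by omega : n + 1 ≠ 0)
  have hn1' : 2 * (n : ℂ) + 2 ≠ 0 := by exact_mod_cast (by omega : 2 * n + 2 ≠ 0)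
  have hHtr : ∑ α, sgn ℓ α * H α α = τ / (n + 1) := by
    have : ∀ α, sgn ℓ α * H α α
        = 2 / (n + 2) * (sgn ℓ α * t α α) - 2 / (n + 2) * (τ / (2 * n + 2)) := by
      intro α
      have e1 : sgn ℓ α * gInv ℓ α α = 1 := by simp [gInv, sgn_mul_self]
      simp only [hH]
      linear_combination (-(2 / (n + 2) * (τ / (2 * n + 2)))) * e1
    simp only [this, Finset.sum_sub_distrib, ← Finset.mul_sum, ← hτ]
    simp only [Finset.sum_const, Finset.card_univ, Fintype.card_fin, nsmul_eq_mul]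
    field_simp
    ring
  set S := symmetrize fun α β γ δ => gInv ℓ α β * H γ δ with hS
  have hSc : ∀ α β γ δ, conj (S α β γ δ) = S β α δ γ := by
    intro α β γ δ
    simp only [hS, symmetrize, map_mul, map_add, map_div₀, map_one, map_ofNat, conj_gInv, hHc]
    ring
  refine ⟨fun α β γ δ => -4 * (s₁ α β γ δ - 2 * S α β γ δ), H, ⟨?_, ?_, ?_, ?_⟩, hHc, ?_⟩
  · intro α β γ δ
    simp only [hs₁, hS, symmetrize]
    ring
  · intro α β γ δ
    simp only [hs₁, hS, symmetrize]
    ring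
  · intro α β γ δ
    simp only [map_mul, map_sub, map_neg, map_ofNat, hs₁c, hSc]
  · intro γ δ
    refine (trace_eq_sum ℓ (fun α β γ δ => -4 * (s₁ α β γ δ - 2 * S α β γ δ)) γ δ).trans ?_
    have h1 := trace_symmetrize_gInv ℓ H γ δ
    rw [hHtr, ← hS] at h1
    have h2 : ∑ α, sgn ℓ α * (-4 * (s₁ α α γ δ - 2 * S α α γ δ))
        = -4 * (t γ δ - 2 * ∑ α, sgn ℓ α * S α α γ δ) := by
      simp only [ht, Finset.mul_sum, ← Finset.sum_sub_distrib]
      refine Finset.sum_congr rfl fun α _ => ?_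
      ring
    rw [h2, h1]
    simp only [hH]
    field_simp
    ring
  · intro z
    have h1 : quartic (fun α β γ δ => -4 * (s₁ α β γ δ - 2 * S α β γ δ)) z
        = -4 * (quartic s₁ z - 2 * quartic S z) := by
      have : (fun α β γ δ => s₁ α β γ δ - 2 * S α β γ δ)
          = s₁ + fun α β γ δ => -2 * S α β γ δ := by
        funext α β γ δ
        simp only [Pi.add_apply]
        ring
      rw [quartic_smul, this, quartic_add, quartic_smul]
      ring
    rw [h1, hs₁q, hS, quartic_symmetrize, ← normSqL_mul_hermForm]
    ring

end Tensors

/-! ### Wirtinger derivatives of quartic forms -/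

section Wirtinger

variable {n : ℕ} {f g : (Fin n → ℂ) → ℂ} {x v : Fin n → ℂ}

theorem del_mul (hf : DifferentiableAt ℝ f x) (hg : DifferentiableAt ℝ g x) :
    del (fun y => f y * g y) x v = del f x v * g x + f x * del g x v := by
  have h := (hf.hasFDerivAt.mul hg.hasFDerivAt).fderiv
  change fderiv ℝ (fun y => f y * g y) x = _ at h
  simp only [del, h, add_apply, smul_apply, smul_eq_mul]
  ring

theorem delBar_mul (hf : DifferentiableAt ℝ f x) (hg : DifferentiableAt ℝ g x) :
    delBar (fun y => f y * g y) x v = delBar f x v * g x + f x * delBar g x v := by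
  have h := (hf.hasFDerivAt.mul hg.hasFDerivAt).fderiv
  change fderiv ℝ (fun y => f y * g y) x = _ at h
  simp only [delBar, h, add_apply, smul_apply, smul_eq_mul]
  ring

theorem del_add (hf : DifferentiableAt ℝ f x) (hg : DifferentiableAt ℝ g x) :
    del (fun y => f y + g y) x v = del f x v + del g x v := by
  simp only [del, fderiv_fun_add hf hg, add_apply]
  ring

theorem del_sum {ι : Type*} (s : Finset ι) {F : ι → (Fin n → ℂ) → ℂ}
    (hF : ∀ i, DifferentiableAt ℝ (F i) x) :
    del (fun y => ∑ i ∈ s, F i y) x v = ∑ i ∈ s, del (F i) x v := by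
  simp only [del, fderiv_fun_sum fun i _ => hF i, sum_apply, Finset.mul_sum,
    ← Finset.sum_sub_distrib, mul_sub]

theorem delBar_sum {ι : Type*} (s : Finset ι) {F : ι → (Fin n → ℂ) → ℂ}
    (hF : ∀ i, DifferentiableAt ℝ (F i) x) :
    delBar (fun y => ∑ i ∈ s, F i y) x v = ∑ i ∈ s, delBar (F i) x v := by
  simp only [delBar, fderiv_fun_sum fun i _ => hF i, sum_apply, Finset.mul_sum,
    ← Finset.sum_add_distrib, mul_add]

theorem hasFDerivAt_coord (α : Fin n) :
    HasFDerivAt (fun y : Fin n → ℂ => y α) (ContinuousLinearMap.proj (R := ℝ) α) x :=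
  (ContinuousLinearMap.proj (R := ℝ) (φ := fun _ : Fin n => ℂ) α).hasFDerivAt

theorem hasFDerivAt_conj_coord (α : Fin n) : HasFDerivAt (fun y : Fin n → ℂ => conj (y α))
    (Complex.conjCLE.toContinuousLinearMap.comp
      (ContinuousLinearMap.proj (R := ℝ) (φ := fun _ : Fin n => ℂ) α)) x :=
  Complex.conjCLE.toContinuousLinearMap.hasFDerivAt.comp x (hasFDerivAt_coord α)

theorem differentiable_conj_coord (α : Fin n) :
    Differentiable ℝ (fun y : Fin n → ℂ => conj (y α)) :=
  fun _ => (hasFDerivAt_conj_coord α).differentiableAt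

theorem del_const (c : ℂ) : del (fun _ : Fin n → ℂ => c) x v = 0 := by simp [del]

theorem delBar_const (c : ℂ) : delBar (fun _ : Fin n → ℂ => c) x v = 0 := by simp [delBar]

theorem del_coord (α : Fin n) : del (fun y : Fin n → ℂ => y α) x v = v α := by
  simp only [del, (hasFDerivAt_coord α).fderiv, ContinuousLinearMap.proj_apply, Pi.smul_apply,
    smul_eq_mul]
  linear_combination -(1 / 2) * v α * Complex.I_mul_I

theorem delBar_coord (α : Fin n) : delBar (fun y : Fin n → ℂ => y α) x v = 0 := by
  simp only [delBar, (hasFDerivAt_coord α).fderiv, ContinuousLinearMap.proj_apply, Pi.smul_apply,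
    smul_eq_mul]
  linear_combination (1 / 2) * v α * Complex.I_mul_I

theorem del_conj_coord (α : Fin n) : del (fun y : Fin n → ℂ => conj (y α)) x v = 0 := by
  simp [del, (hasFDerivAt_conj_coord α).fderiv]
  linear_combination conj (v α) * Complex.I_mul_I

theorem delBar_conj_coord (α : Fin n) :
    delBar (fun y : Fin n → ℂ => conj (y α)) x v = conj (v α) := by
  simp [delBar, (hasFDerivAt_conj_coord α).fderiv]
  linear_combination -(1 / 2) * conj (v α) * Complex.I_mul_I

theorem delBar_quartic (s : Fin n → Fin n → Fin n → Fin n → ℂ) (x v : Fin n → ℂ) :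
    delBar (quartic s) x v = ∑ α, ∑ β, ∑ γ, ∑ δ, s α β γ δ *
      (x α * x γ * (conj (v β) * conj (x δ) + conj (x β) * conj (v δ))) := by
  have hc := fun α => differentiable_conj_coord (n := n) α
  unfold quartic
  rw [delBar_sum _ fun α => by fun_prop]
  refine Finset.sum_congr rfl fun α _ => ?_
  rw [delBar_sum _ fun β => by fun_prop]
  refine Finset.sum_congr rfl fun β _ => ?_
  rw [delBar_sum _ fun γ => by fun_prop]
  refine Finset.sum_congr rfl fun γ _ => ?_
  rw [delBar_sum _ fun δ => by fun_prop]
  refine Finset.sum_congr rfl fun δ _ => ?_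
  rw [delBar_mul (by fun_prop) (by fun_prop), delBar_mul (by fun_prop) (by fun_prop),
    delBar_mul (by fun_prop) (by fun_prop), delBar_mul (by fun_prop) (by fun_prop),
    delBar_const, delBar_coord, delBar_coord, delBar_conj_coord, delBar_conj_coord]
  ring

theorem del_delBar_quartic (s : Fin n → Fin n → Fin n → Fin n → ℂ) (x v : Fin n → ℂ) :
    del (fun ζ => delBar (quartic s) ζ v) x v = ∑ α, ∑ β, ∑ γ, ∑ δ, s α β γ δ *
      ((v α * x γ + x α * v γ) * (conj (v β) * conj (x δ) + conj (x β) * conj (v δ))) := by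
  have hc := fun α => differentiable_conj_coord (n := n) α
  simp only [delBar_quartic]
  rw [del_sum _ fun α => by fun_prop]
  refine Finset.sum_congr rfl fun α _ => ?_
  rw [del_sum _ fun β => by fun_prop]
  refine Finset.sum_congr rfl fun β _ => ?_
  rw [del_sum _ fun γ => by fun_prop]
  refine Finset.sum_congr rfl fun γ _ => ?_
  rw [del_sum _ fun δ => by fun_prop]
  refine Finset.sum_congr rfl fun δ _ => ?_
  rw [del_mul (by fun_prop) (by fun_prop), del_mul (by fun_prop) (by fun_prop),
    del_mul (by fun_prop) (by fun_prop), del_add (by fun_prop) (by fun_prop),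
    del_mul (by fun_prop) (by fun_prop), del_mul (by fun_prop) (by fun_prop),
    del_const, del_const, del_const, del_coord, del_coord, del_conj_coord, del_conj_coord]
  ring

/-- Each `∂²/∂z_j∂z̄_j` removes one of two `z` factors and one of two `z̄` factors. By symmetry the
four contributions are equal, so the Laplacian is four times the contraction of the vanishing trace
with `z_γ z̄_δ`. -/
theorem laplacianL_quartic {ℓ : ℕ} {s : Fin n → Fin n → Fin n → Fin n → ℂ}
    (hs : IsChernMoserTensor ℓ s) (z : Fin n → ℂ) : laplacianL ℓ (quartic s) z = 0 := by
  have htr : ∀ γ δ, ∑ j, sgn ℓ j * s j j γ δ = 0 := fun γ δ => by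
    rw [← trace_eq_sum, hs.trace_free]
  have hsl := hs.symm_left
  have hsr : ∀ α β γ δ, s α β γ δ = s α δ γ β := fun α β γ δ => hs.symm_pair γ β α δ
  have hj : ∀ j : Fin n, del (fun ζ => delBar (quartic s) ζ (Pi.single j 1)) z (Pi.single j 1)
      = 4 * ∑ γ, ∑ δ, s j j γ δ * (z γ * conj (z δ)) := by
    intro j
    rw [del_delBar_quartic]
    have hsplit : ∀ α β γ δ, s α β γ δ *
        (((Pi.single j 1 : Fin n → ℂ) α * z γ + z α * (Pi.single j 1 : Fin n → ℂ) γ) *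
          (conj ((Pi.single j 1 : Fin n → ℂ) β) * conj (z δ)
            + conj (z β) * conj ((Pi.single j 1 : Fin n → ℂ) δ)))
        = (if α = j then if β = j then s j j γ δ * (z γ * conj (z δ)) else 0 else 0)
        + (if α = j then if δ = j then s j j γ β * (z γ * conj (z β)) else 0 else 0)
        + (if γ = j then if β = j then s j j α δ * (z α * conj (z δ)) else 0 else 0)
        + (if γ = j then if δ = j then s j j α β * (z α * conj (z β)) else 0 else 0) := by
      intro α β γ δ
      have e1 : ∀ a, (Pi.single j 1 : Fin n → ℂ) a = if a = j then 1 else 0 := fun a => by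
        rw [Pi.single_apply]
      have e2 : ∀ a, conj ((Pi.single j 1 : Fin n → ℂ) a) = if a = j then 1 else 0 := fun a => by
        rw [e1]; split_ifs <;> simp
      rw [e1, e1, e2, e2]
      have t1 : (if α = j then if β = j then s j j γ δ * (z γ * conj (z δ)) else 0 else 0)
          = (if α = j then 1 else 0) * (if β = j then 1 else 0) *
            (s α β γ δ * (z γ * conj (z δ))) := by
        split_ifs with h1 h2 <;> simp [*]
      have t2 : (if α = j then if δ = j then s j j γ β * (z γ * conj (z β)) else 0 else 0)
          = (if α = j then 1 else 0) * (if δ = j then 1 else 0) *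
            (s α β γ δ * (z γ * conj (z β))) := by
        rw [hsr α β γ δ]
        split_ifs with h1 h2 <;> simp [*]
      have t3 : (if γ = j then if β = j then s j j α δ * (z α * conj (z δ)) else 0 else 0)
          = (if γ = j then 1 else 0) * (if β = j then 1 else 0) *
            (s α β γ δ * (z α * conj (z δ))) := by
        rw [hsl α β γ δ]
        split_ifs with h1 h2 <;> simp [*]
      have t4 : (if γ = j then if δ = j then s j j α β * (z α * conj (z β)) else 0 else 0)
          = (if γ = j then 1 else 0) * (if δ = j then 1 else 0) *
            (s α β γ δ * (z α * conj (z β))) := by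
        rw [hsl α β γ δ, hsr γ β α δ]
        split_ifs with h1 h2 <;> simp [*]
      rw [t1, t2, t3, t4]
      ring
    simp only [hsplit, Finset.sum_add_distrib]
    have k1 : ∑ α, ∑ β, ∑ γ, ∑ δ,
        (if α = j then if β = j then s j j γ δ * (z γ * conj (z δ)) else 0 else 0)
        = ∑ γ, ∑ δ, s j j γ δ * (z γ * conj (z δ)) := by
      rw [Finset.sum_eq_single j (fun b _ hb => by simp [hb]) (by simp),
        Finset.sum_eq_single j (fun b _ hb => by simp [hb]) (by simp)]
      simp
    have k2 : ∑ α, ∑ β, ∑ γ, ∑ δ,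
        (if α = j then if δ = j then s j j γ β * (z γ * conj (z β)) else 0 else 0)
        = ∑ γ, ∑ δ, s j j γ δ * (z γ * conj (z δ)) := by
      rw [Finset.sum_eq_single j (fun b _ hb => by simp [hb]) (by simp), Finset.sum_comm]
      simp
    have k3 : ∑ α, ∑ β, ∑ γ, ∑ δ,
        (if γ = j then if β = j then s j j α δ * (z α * conj (z δ)) else 0 else 0)
        = ∑ γ, ∑ δ, s j j γ δ * (z γ * conj (z δ)) := by
      refine Finset.sum_congr rfl fun α _ => ?_
      rw [Finset.sum_eq_single j (fun b _ hb => by simp [hb]) (by simp),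
        Finset.sum_eq_single j (fun b _ hb => by simp [hb]) (by simp)]
      simp
    have k4 : ∑ α, ∑ β, ∑ γ, ∑ δ,
        (if γ = j then if δ = j then s j j α β * (z α * conj (z β)) else 0 else 0)
        = ∑ γ, ∑ δ, s j j γ δ * (z γ * conj (z δ)) := by
      refine Finset.sum_congr rfl fun α _ => Finset.sum_congr rfl fun β _ => ?_
      rw [Finset.sum_eq_single j (fun b _ hb => by simp [hb]) (by simp)]
      simp
    rw [k1, k2, k3, k4]
    ring
  unfold laplacianL
  simp only [hj]
  have : ∑ j, sgn ℓ j * (4 * ∑ γ, ∑ δ, s j j γ δ * (z γ * conj (z δ)))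
      = 4 * ∑ γ, ∑ δ, (∑ j, sgn ℓ j * s j j γ δ) * (z γ * conj (z δ)) := by
    simp only [Finset.mul_sum, Finset.sum_mul]
    rw [Finset.sum_comm]
    refine Finset.sum_congr rfl fun γ _ => ?_
    rw [Finset.sum_comm]
    refine Finset.sum_congr rfl fun δ _ => Finset.sum_congr rfl fun j _ => ?_
    ring
  rw [this]
  simp [htr]

end Wirtinger

/-! ### The normalization in degrees two, three and four -/

section Steps

variable {n : ℕ}

theorem hermRe_add (ℓ : ℕ) (f g z : Fin n → ℂ) :
    hermRe ℓ (f + g) z = hermRe ℓ f z + hermRe ℓ g z := by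
  simp only [hermRe, ← Complex.add_re, ← Finset.sum_add_distrib]
  congr 1
  refine Finset.sum_congr rfl fun j _ => ?_
  rw [Pi.add_apply]
  ring

theorem hermRe_isBigO (ℓ : ℕ) {f g : Yn n → Fin n → ℂ} {a b : ℕ}
    (hf : f =O[𝓝 0] fun y => ‖y‖ ^ a) (hg : g =O[𝓝 0] fun y => ‖y‖ ^ b) :
    (fun y => hermRe ℓ (f y) (g y)) =O[𝓝 0] fun y => ‖y‖ ^ (a + b) := by
  have h1 : (fun y => hermRe ℓ (f y) (g y)) =O[𝓝 0] fun y => ‖f y‖ * ‖g y‖ := by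
    refine IsBigO.of_bound n (Eventually.of_forall fun y => ?_)
    rw [norm_mul, norm_norm, norm_norm]
    exact abs_hermRe_le ℓ (f y) (g y)
  refine h1.trans ((hf.norm_left.mul hg.norm_left).congr_right fun y => ?_)
  rw [pow_add]

theorem coord_isBigO (j : Fin n) : (fun y : Yn n => y.1 j) =O[𝓝 0] fun y => ‖y‖ :=
  IsBigO.of_bound 1 (Eventually.of_forall fun y => by
    rw [one_mul, norm_norm]
    exact (norm_le_pi_norm y.1 j).trans (norm_fst_le y))

theorem conj_coord_isBigO (j : Fin n) : (fun y : Yn n => conj (y.1 j)) =O[𝓝 0] fun y => ‖y‖ :=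
  IsBigO.of_bound 1 (Eventually.of_forall fun y => by
    rw [one_mul, norm_norm, RCLike.norm_conj]
    exact (norm_le_pi_norm y.1 j).trans (norm_fst_le y))

theorem contDiff_qf (ℓ : ℕ) : ContDiff ℝ ∞ (fun y : Yn n => qf ℓ y.1) := by
  have hc : ∀ j, ContDiff ℝ ∞ (fun y : Yn n => conj (y.1 j)) := fun j =>
    Complex.conjCLE.contDiff.comp (by fun_prop)
  unfold qf normSqL
  exact Complex.reCLM.contDiff.comp
    (ContDiff.sum fun j _ => contDiff_const.mul (ContDiff.mul (by fun_prop) (hc j)))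

theorem isBigO_vec {k : ℕ} {F : Fin n → Cn1 n → ℂ} (hF : ∀ j, IsHolPoly k (F j)) :
    (fun x j => F j x) =O[𝓝 0] fun x : Cn1 n => ‖x‖ ^ k :=
  isBigO_pi.2 fun j => (hF j).isBigO

theorem isBigO_vec_lift {k : ℕ} {F : Fin n → Cn1 n → ℂ} (hF : ∀ j, IsHolPoly k (F j))
    {N : Yn n → ℝ} (hN : N =O[𝓝 0] fun y => ‖y‖ ^ 2) :
    (fun y j => F j (lift y (N y))) =O[𝓝 0] fun y : Yn n => ‖y‖ ^ k := by
  have hX := lift_isBigO hN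
  have hXt : Tendsto (fun y => lift y (N y)) (𝓝 0) (𝓝 0) :=
    tendsto_zero_of_isBigO_pow (k := 1) one_ne_zero (by simpa using hX)
  exact ((isBigO_vec hF).comp_tendsto hXt).trans (hX.norm_left.pow k)

theorem IsHolPoly.im_sub_isBigO {k : ℕ} {g : Cn1 n → ℂ} (hg : IsHolPoly k g) {N : Yn n → ℝ}
    (hN : N =O[𝓝 0] fun y => ‖y‖ ^ 2) :
    (fun y => (g (lift y (N y))).im - (g (lift y 0)).im) =O[𝓝 0] fun y => ‖y‖ ^ (k + 1) := by
  refine IsBigO.trans (IsBigO.of_bound 1 (Eventually.of_forall fun y => ?_))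
    (hg.lift_sub_isBigO hN)
  rw [one_mul, ← Complex.sub_im]
  exact Complex.abs_im_le_norm _

theorem re_pairing_sub_isBigO {k : ℕ} {F : Fin n → Cn1 n → ℂ} (hF : ∀ j, IsHolPoly k (F j))
    {N : Yn n → ℝ} (hN : N =O[𝓝 0] fun y => ‖y‖ ^ 2) :
    (fun y : Yn n => (∑ j, F j (lift y (N y)) * conj (y.1 j)).re
      - (∑ j, F j (lift y 0) * conj (y.1 j)).re) =O[𝓝 0] fun y => ‖y‖ ^ (k + 2) := by
  have h1 : (fun y : Yn n => ∑ j, (F j (lift y (N y)) - F j (lift y 0)) * conj (y.1 j))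
      =O[𝓝 0] fun y => ‖y‖ ^ (k + 2) := by
    refine IsBigO.fun_sum fun j _ => ?_
    refine (((hF j).lift_sub_isBigO hN).mul (conj_coord_isBigO j)).congr_right fun y => ?_
    rw [← pow_succ]
  refine IsBigO.trans (IsBigO.of_bound 1 (Eventually.of_forall fun y => ?_)) h1
  rw [one_mul, ← Complex.sub_re, ← Finset.sum_sub_distrib]
  simp only [← sub_mul]
  exact Complex.abs_re_le_norm _

theorem hermRe_neg_half_sgn (ℓ : ℕ) (F z : Fin n → ℂ) :
    hermRe ℓ (fun j => -(1 / 2) * sgn ℓ j * F j) z = -(1 / 2) * (∑ j, F j * conj (z j)).re := by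
  have : ∑ j, sgn ℓ j * (-(1 / 2) * sgn ℓ j * F j * conj (z j))
      = ((-(1 / 2) : ℝ) : ℂ) * ∑ j, F j * conj (z j) := by
    rw [Finset.mul_sum]
    refine Finset.sum_congr rfl fun j _ => ?_
    push_cast
    linear_combination (-(1 / 2) * F j * conj (z j)) * sgn_mul_self ℓ j
  rw [hermRe, this, Complex.re_ofReal_mul]

variable {M : Set (Cn1 n)} {p : Cn1 n} {T : Cn1 n ≃L[ℂ] Cn1 n} {Γ : Cn1 n → Cn1 n} {φ : Yn n → ℝ}

theorem IsGraphChart.exists_leading (h : IsGraphChart M p T Γ φ) (ℓ : ℕ) {d : ℕ}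
    (hφ : (fun y => φ y - qf ℓ y.1) =O[𝓝 0] fun y => ‖y‖ ^ d) :
    ∃ m : ContinuousMultilinearMap ℝ (fun _ : Fin d => Yn n) ℝ,
      (fun y => φ y - (qf ℓ y.1 + m fun _ => y)) =O[𝓝 0] fun y => ‖y‖ ^ (d + 1) := by
  have hc : ContDiffAt ℝ (d + 1) (fun y => φ y - qf ℓ y.1) 0 :=
    (h.smooth.self_of_nhds.sub (contDiff_qf ℓ).contDiffAt).of_le (WithTop.coe_le_coe.2 le_top)
  refine ⟨(d.factorial : ℝ)⁻¹ • iteratedFDeriv ℝ d (fun y => φ y - qf ℓ y.1) 0,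
    (sub_leading_term_isBigO hc hφ).congr_left fun y => ?_⟩
  simp only [smul_apply]
  ring

/-- A linear `f` would not be tangent to the identity, so only `g` is available in degree 2. The
hypothesis `hm` says that `m` has no Hermitian part in `z`, and `Im g` is then all of `m`. -/
theorem IsGraphChart.step_two (h : IsGraphChart M p T Γ φ) (ℓ : ℕ)
    (m : ContinuousMultilinearMap ℝ (fun _ : Fin 2 => Yn n) ℝ)
    (hφ : (fun y => φ y - (qf ℓ y.1 + m fun _ => y)) =O[𝓝 0] fun y => ‖y‖ ^ 3)
    (hm : ∀ z, (m fun _ => (z, 0)) + (m fun _ => (Complex.I • z, 0)) = 0) :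
    ∃ Γ' φ', IsGraphChart M p T Γ' φ' ∧
      (fun y => φ' y - qf ℓ y.1) =O[𝓝 0] fun y => ‖y‖ ^ 3 := by
  obtain ⟨g, f, s, hg, hf, hs, hw, hsplit⟩ := hasSplitting_diag (n := n) (e := 1) (by norm_num) m
  have hs0 := hs (by norm_num)
  -- Under `z ↦ iz` the Hermitian pairing is invariant while the quadratic `Im g` changes sign; `hm`
  -- therefore isolates twice the pairing.
  have hpair : ∀ y : Yn n, (∑ j, f j (lift y 0) * conj (y.1 j)).re = 0 := by
    intro y
    have h1 : ∀ j, f j (lift y 0) = f j (y.1, 0) := fun j => hw rfl j _ _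
    simp only [h1]
    have e1 := hsplit (y.1, 0)
    have e2 := hsplit (Complex.I • y.1, 0)
    have l1 : lift ((y.1, 0) : Yn n) 0 = (y.1, 0) := rfl
    have l2 : lift ((Complex.I • y.1, 0) : Yn n) 0 = Complex.I • ((y.1, 0) : Cn1 n) := by
      rw [Prod.smul_mk, smul_zero]; rfl
    rw [l1, hs0, quartic_zero, Complex.ofReal_re] at e1
    rw [l2, hs0, quartic_zero, Complex.ofReal_re, hg.smul] at e2
    have e3 : ∑ j, f j (Complex.I • (y.1, 0)) * conj ((Complex.I • y.1) j)
        = ∑ j, f j (y.1, 0) * conj (y.1 j) := by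
      refine Finset.sum_congr rfl fun j _ => ?_
      rw [(hf j).smul, Pi.smul_apply, smul_eq_mul, map_mul, Complex.conj_I]
      linear_combination (-(f j (y.1, 0) * conj (y.1 j))) * Complex.I_mul_I
    have e4 : (Complex.I ^ (1 + 1) * g (y.1, 0)).im = -(g (y.1, 0)).im := by
      norm_num [Complex.I_sq]
    simp only [e3, e4, Complex.zero_re, add_zero] at e1 e2
    have := hm y.1
    linarith
  have hN : (fun y : Yn n => qf ℓ y.1) =O[𝓝 0] fun y => ‖y‖ ^ 2 := qf_isBigO ℓ
  refine h.normalize ℓ le_rfl m hφ (f := fun _ => 0) (g := g) contDiff_const hg.contDiff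
    (isBigO_zero _ _) hg.isBigO hN ?_
  refine (hg.im_sub_isBigO hN).congr_left fun y => ?_
  have e1 := hsplit y
  rw [hpair y, hs0, quartic_zero, Complex.ofReal_re] at e1
  rw [e1]
  simp [hermRe, qf, normSqL]

theorem IsGraphChart.step_three (h : IsGraphChart M p T Γ φ) (ℓ : ℕ)
    (hφ : (fun y => φ y - qf ℓ y.1) =O[𝓝 0] fun y => ‖y‖ ^ 3) :
    ∃ Γ' φ', IsGraphChart M p T Γ' φ' ∧
      (fun y => φ' y - qf ℓ y.1) =O[𝓝 0] fun y => ‖y‖ ^ 4 := by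
  obtain ⟨m, hm⟩ := h.exists_leading ℓ hφ
  obtain ⟨g, f, s, hg, hf, hs, -, hsplit⟩ := hasSplitting_diag (n := n) (e := 2) (by norm_num) m
  have hs0 := hs (by norm_num)
  have hN : (fun y : Yn n => qf ℓ y.1) =O[𝓝 0] fun y => ‖y‖ ^ 2 := qf_isBigO ℓ
  have hf' : ∀ j, IsHolPoly 2 (fun x => -(1 / 2) * sgn ℓ j * f j x) := fun j => (hf j).const_mul _
  -- The coefficient `-(1/2) sgn` makes `2 Re⟨f, z⟩` in the model Hermitian form equal to `-Re ∑ f_j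
  -- z̄_j`. The leftover `|f|_ℓ²` already has degree 4.
  refine h.normalize ℓ (by norm_num) m hm (f := fun x j => -(1 / 2) * sgn ℓ j * f j x) (g := g)
    (contDiff_pi.2 fun j => (hf' j).contDiff) hg.contDiff (isBigO_vec hf')
    (hg.isBigO.trans (isBigO_pow_of_le (by norm_num))) hN ?_
  have hv := isBigO_vec_lift hf' hN
  have hvv := hermRe_isBigO ℓ hv hv
  refine (((hg.im_sub_isBigO hN).add (re_pairing_sub_isBigO hf hN)).sub hvv).congr_left fun y => ?_
  have e1 := hsplit y
  rw [hs0, quartic_zero, Complex.ofReal_re] at e1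
  rw [e1, hermRe_neg_half_sgn ℓ (fun j => f j (lift y (qf ℓ y.1))) y.1,
    qf_eq_hermRe ℓ (fun j => -(1 / 2) * sgn ℓ j * f j (lift y (qf ℓ y.1)))]
  simp only [Complex.zero_re]
  ring

/-- The linear map `B` with `⟨Bz, z⟩ = i H(z, z̄)`. -/
def skewVec (ℓ : ℕ) (H : Fin n → Fin n → ℂ) (z : Fin n → ℂ) (k : Fin n) : ℂ :=
  Complex.I * sgn ℓ k * ∑ α, H α k * z α

/-- For Hermitian `H` the right side is `-Im w · H(z)`: the shift `wBz` has no effect proportional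
to `u`, and on the graph it contributes `-vH`. -/
theorem hermRe_smul_skewVec (ℓ : ℕ) (H : Fin n → Fin n → ℂ) (w : ℂ) (z : Fin n → ℂ) :
    hermRe ℓ (fun k => w * skewVec ℓ H z k) z = (Complex.I * w * hermForm H z).re := by
  rw [hermRe, hermForm, Finset.sum_comm, Finset.mul_sum]
  congr 1
  refine Finset.sum_congr rfl fun k _ => ?_
  have : ∑ α, H α k * (z α * conj (z k)) = (∑ α, H α k * z α) * conj (z k) := by
    rw [Finset.sum_mul]
    refine Finset.sum_congr rfl fun α _ => ?_
    ring
  rw [this, skewVec]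
  linear_combination (Complex.I * w * (∑ α, H α k * z α) * conj (z k)) * sgn_mul_self ℓ k

theorem qf_smul (ℓ : ℕ) (w : ℂ) (b : Fin n → ℂ) :
    qf ℓ (fun k => w * b k) = (w.re ^ 2 + w.im ^ 2) * qf ℓ b := by
  have : normSqL ℓ (fun k => w * b k) = ((w.re ^ 2 + w.im ^ 2 : ℝ) : ℂ) * normSqL ℓ b := by
    have hw : w * conj w = ((w.re ^ 2 + w.im ^ 2 : ℝ) : ℂ) := by
      rw [Complex.mul_conj, Complex.normSq_apply, sq, sq]
    rw [← hw, normSqL, normSqL, Finset.mul_sum]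
    refine Finset.sum_congr rfl fun k _ => ?_
    rw [map_mul]
    ring
  rw [qf, this, Complex.re_ofReal_mul, qf]

/-- Exhibits `|Bz|_ℓ²` as linear in `z̄` with holomorphic coefficients, so that `u²|Bz|_ℓ²` can be
absorbed into the `f_j`. -/
theorem qf_skewVec (ℓ : ℕ) (H : Fin n → Fin n → ℂ) (z : Fin n → ℂ) :
    qf ℓ (skewVec ℓ H z) =
      (∑ k, (∑ j, -Complex.I * conj (H k j) * skewVec ℓ H z j) * conj (z k)).re := by
  have : ∀ j, conj (skewVec ℓ H z j) = -Complex.I * sgn ℓ j * ∑ k, conj (H k j) * conj (z k) := by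
    intro j
    simp only [skewVec, map_mul, map_sum, Complex.conj_I, conj_sgn]
  rw [qf, normSqL]
  congr 1
  simp only [this, Finset.mul_sum, Finset.sum_mul]
  rw [Finset.sum_comm]
  refine Finset.sum_congr rfl fun k _ => Finset.sum_congr rfl fun j _ => ?_
  linear_combination (-Complex.I * conj (H k j) * skewVec ℓ H z j * conj (z k)) * sgn_mul_self ℓ j

theorem quartic_isBigO (s : Fin n → Fin n → Fin n → Fin n → ℂ) :
    (fun y : Yn n => quartic s y.1) =O[𝓝 0] fun y => ‖y‖ ^ 4 := by
  unfold quartic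
  refine IsBigO.fun_sum fun α _ => IsBigO.fun_sum fun β _ => IsBigO.fun_sum fun γ _ => IsBigO.fun_sum fun δ _ => ?_
  refine ((((coord_isBigO α).mul (conj_coord_isBigO β)).mul (coord_isBigO γ)).mul
    (conj_coord_isBigO δ)).const_mul_left _ |>.congr_right fun y => ?_
  ring

theorem hermForm_isBigO (H : Fin n → Fin n → ℂ) :
    (fun y : Yn n => hermForm H y.1) =O[𝓝 0] fun y => ‖y‖ ^ 2 := by
  unfold hermForm
  refine IsBigO.fun_sum fun α _ => IsBigO.fun_sum fun β _ => ?_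
  refine ((coord_isBigO α).mul (conj_coord_isBigO β)).const_mul_left _ |>.congr_right fun y => ?_
  ring

theorem quartic_eq_re {ℓ : ℕ} {s : Fin n → Fin n → Fin n → Fin n → ℂ}
    (hs : IsChernMoserTensor ℓ s) (z : Fin n → ℂ) : ((quartic s z).re : ℂ) = quartic s z := by
  rw [← Complex.conj_eq_iff_re, conj_quartic]
  congr 1
  funext α β γ δ
  rw [hs.conj_eq]

theorem hermForm_eq_re {H : Fin n → Fin n → ℂ} (hH : ∀ α β, conj (H α β) = H β α)
    (z : Fin n → ℂ) : ((hermForm H z).re : ℂ) = hermForm H z := by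
  rw [← Complex.conj_eq_iff_re, hermForm]
  simp only [map_sum, map_mul, hH, Complex.conj_conj]
  rw [Finset.sum_comm]
  refine Finset.sum_congr rfl fun α _ => Finset.sum_congr rfl fun β _ => ?_
  ring

theorem isBigO_re {f : Yn n → ℂ} {k : ℕ} (hf : f =O[𝓝 0] fun y => ‖y‖ ^ k) :
    (fun y => (f y).re) =O[𝓝 0] fun y => ‖y‖ ^ k :=
  IsBigO.trans (IsBigO.of_bound 1 (Eventually.of_forall fun y => by
    rw [one_mul]; exact Complex.abs_re_le_norm _)) hf

theorem IsGraphChart.step_four (h : IsGraphChart M p T Γ φ) (ℓ : ℕ)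
    (hφ : (fun y => φ y - qf ℓ y.1) =O[𝓝 0] fun y => ‖y‖ ^ 4) :
    ∃ Γ' φ' s, IsGraphChart M p T Γ' φ' ∧ IsChernMoserTensor ℓ s ∧
      (fun y => φ' y - (qf ℓ y.1 - 1 / 4 * (quartic s y.1).re)) =O[𝓝 0] fun y => ‖y‖ ^ 5 := by
  obtain ⟨m, hm⟩ := h.exists_leading ℓ hφ
  obtain ⟨g, f, s₀, hg, hf, -, -, hsplit⟩ := hasSplitting_diag (n := n) (e := 3) (by norm_num) m
  obtain ⟨s, H, hs, hH, hdec⟩ := exists_trace_decomposition ℓ s₀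
  set b : Fin n → Cn1 n → ℂ := fun k x => skewVec ℓ H x.1 k with hb
  have hbp : ∀ k, IsHolPoly 1 (b k) := fun k =>
    (IsHolPoly.sum _ fun α => (IsHolPoly.fst α).const_mul _).const_mul _
  have hwb : ∀ k, IsHolPoly 2 (fun x => x.2 * b k x) := fun k => IsHolPoly.snd.mul (hbp k)
  -- The shift `wBz` has only degree 2, so its square `|w|² |Bz|_ℓ²` still has the degree 4 part `u²
  -- |Bz|_ℓ²`. The extra term in `F`, quadratic in `w`, compensates it.
  set F : Fin n → Cn1 n → ℂ := fun k x => f k x +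
    x.2 * (x.2 * ∑ j, -Complex.I * conj (H k j) * b j x) with hF
  have hFp : ∀ k, IsHolPoly 3 (F k) := fun k => (hf k).add (IsHolPoly.snd.mul
    (IsHolPoly.snd.mul (IsHolPoly.sum _ fun j => (hbp j).const_mul _)))
  have hf₃ : ∀ k, IsHolPoly 3 (fun x => -(1 / 2) * sgn ℓ k * F k x) := fun k => (hFp k).const_mul _
  set N : Yn n → ℝ := fun y => qf ℓ y.1 - 1 / 4 * (quartic s y.1).re with hNdef
  have hqs : (fun y : Yn n => (quartic s y.1).re) =O[𝓝 0] fun y => ‖y‖ ^ 4 :=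
    isBigO_re (quartic_isBigO s)
  have hN : N =O[𝓝 0] fun y => ‖y‖ ^ 2 :=
    (qf_isBigO ℓ).sub ((hqs.trans (isBigO_pow_of_le (by norm_num))).const_mul_left _)
  obtain ⟨Γ', φ', h1, h2⟩ := h.normalize ℓ (by norm_num) m hm
    (f := fun x => (fun k => x.2 * b k x) + fun k => -(1 / 2) * sgn ℓ k * F k x) (g := g)
    ((contDiff_pi.2 fun k => (hwb k).contDiff).add (contDiff_pi.2 fun k => (hf₃ k).contDiff))
    hg.contDiff ((isBigO_vec hwb).add ((isBigO_vec hf₃).trans (isBigO_pow_of_le (by norm_num))))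
    (hg.isBigO.trans (isBigO_pow_of_le (by norm_num))) hN (by
      have hv := isBigO_vec_lift hf₃ hN
      have hwv := isBigO_vec_lift hwb hN
      have hbv := isBigO_vec_lift hbp hN
      have r1 := hg.im_sub_isBigO hN
      have r2 := re_pairing_sub_isBigO hFp hN
      -- `r3` arises because `vH` uses `v = N` instead of `|z|_ℓ²`, and `r4` is the part of
      -- `|w|²|Bz|_ℓ²` coming from `Im w = N`; both have degree 6.
      have r3 : (fun y : Yn n => (quartic s y.1).re * (hermForm H y.1).re)
          =O[𝓝 0] fun y => ‖y‖ ^ 5 := by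
        refine IsBigO.trans ?_ (isBigO_pow_of_le (by norm_num : 5 ≤ 6))
        exact (hqs.mul (isBigO_re (hermForm_isBigO H))).congr_right fun y => by ring
      have r4 : (fun y => N y ^ 2 * qf ℓ (skewVec ℓ H y.1)) =O[𝓝 0] fun y => ‖y‖ ^ 5 := by
        refine IsBigO.trans ?_ (isBigO_pow_of_le (by norm_num : 5 ≤ 6))
        exact ((hN.pow 2).mul (hermRe_isBigO ℓ hbv hbv)).congr_right fun y => by ring
      have r5 := hermRe_isBigO ℓ hv hwv
      have r6 := (hermRe_isBigO ℓ hv hv).trans (isBigO_pow_of_le (by norm_num : 5 ≤ 3 + 3))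
      refine (((((r1.add r2).sub (r3.const_mul_left (1 / 2))).sub r4).sub
        (r5.const_mul_left 2)).sub r6).congr_left fun y => ?_
      have e1 := hsplit y
      rw [Complex.ofReal_re] at e1
      have e2 : (quartic s₀ y.1).re - 2 * (qf ℓ y.1 * (hermForm H y.1).re)
          = -(1 / 4) * (quartic s y.1).re := by
        have := hdec y.1
        rw [← quartic_eq_re hs, ← normSqL_eq_re, ← hermForm_eq_re hH] at this
        rw [qf]
        apply Complex.ofReal_injective
        push_cast
        exact this
      have e3 : (∑ k, F k (lift y 0) * conj (y.1 k)).re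
          = (∑ k, f k (lift y 0) * conj (y.1 k)).re + y.2 ^ 2 * qf ℓ (skewVec ℓ H y.1) := by
        rw [qf_skewVec, ← Complex.re_ofReal_mul, ← Complex.add_re, Finset.mul_sum,
          ← Finset.sum_add_distrib]
        congr 1
        refine Finset.sum_congr rfl fun k _ => ?_
        have hl : (lift y 0).2 = (y.2 : ℂ) := rfl
        simp only [hF, hb, hl]
        push_cast
        change (_ + _ * (_ * ∑ j, -Complex.I * conj (H k j) * skewVec ℓ H y.1 j)) * _ = _
        ring
      have e4 : hermRe ℓ (fun k => (lift y (N y)).2 * b k (lift y (N y))) y.1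
          = -(N y * (hermForm H y.1).re) := by
        refine (hermRe_smul_skewVec ℓ H (lift y (N y)).2 y.1).trans ?_
        rw [← hermForm_eq_re hH]
        simp [lift]
      have e5 : qf ℓ (fun k => (lift y (N y)).2 * b k (lift y (N y)))
          = (y.2 ^ 2 + N y ^ 2) * qf ℓ (skewVec ℓ H y.1) := qf_smul ℓ _ _
      have e6 : N y = qf ℓ y.1 - 1 / 4 * (quartic s y.1).re := rfl
      rw [qf_add, hermRe_add, e4, e5,
        hermRe_neg_half_sgn ℓ (fun k => F k (lift y (N y))) y.1, e1, e3,
        qf_eq_hermRe ℓ (fun k => -(1 / 2) * sgn ℓ k * F k (lift y (N y)))]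
      linear_combination (1 + 2 * (hermForm H y.1).re) * (-e6) + e2)
  exact ⟨Γ', φ', s, h1, hs, h2⟩

end Steps

/-! ### The affine normalization and the normal form -/

section Final

variable {n : ℕ} {M : Set (Cn1 n)} {p : Cn1 n}

/-- The equation `c ρ(p + Tx) = v + (Hessian)/2 + O(3)` is solved to second order by minus half the
Hessian at `v = 0`; putting `v = N = O(2)` into the Hessian changes it only at order 3. -/
theorem exists_affine_chart {ρ : Cn1 n → ℝ} (hp : p ∈ M) (hρ : IsLocalDefining M p ρ)
    (T : Cn1 n ≃L[ℂ] Cn1 n) {c : ℝ} (hc : c ≠ 0) (hT : ∀ x, c * fderiv ℝ ρ p (T x) = x.2.im) :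
    ∃ φ, IsGraphChart M p T (fun x => p + T x) φ ∧
      (fun y => φ y - -(c / 2) * hess ρ p (T (lift y 0)) (T (lift y 0))) =O[𝓝 0]
        fun y => ‖y‖ ^ 3 := by
  set TR : Cn1 n →L[ℝ] Cn1 n := (T : Cn1 n →L[ℂ] Cn1 n).restrictScalars ℝ with hTR
  have hTRa : ∀ x, TR x = T x := fun x => rfl
  set A : Cn1 n → Cn1 n := fun x => p + T x with hA
  have hA0 : A 0 = p := by simp [hA]
  have hAd : ∀ x, HasFDerivAt A TR x := fun x => TR.hasFDerivAt.const_add p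
  have hAc : ContDiff ℂ ∞ A := contDiff_const.add T.contDiff
  have hAt : Tendsto A (𝓝 0) (𝓝 p) := by
    have := hAc.continuous.tendsto 0
    rwa [hA0] at this
  set H : Cn1 n → ℝ := fun x => c * ρ (A x) with hH
  have hρs := hρ.eventually_contDiffAt
  have hHs : ∀ᶠ x in 𝓝 0, ContDiffAt ℝ ∞ H x := by
    filter_upwards [hAt.eventually hρs] with x hx
    exact contDiffAt_const.mul (hx.comp x (hAc.restrict_scalars ℝ).contDiffAt)
  have hH0 : H 0 = 0 := by
    rw [hH]
    simp only [hA0, hρ.eventually_mem_iff.self_of_nhds.1 hp, mul_zero]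
  have hHd : ∀ᶠ x in 𝓝 0, ∀ v, fderiv ℝ H x v = c * fderiv ℝ ρ (A x) (T v) := by
    filter_upwards [hAt.eventually hρs] with x hx v
    have h1 : HasFDerivAt ρ (fderiv ℝ ρ (A x)) (A x) :=
      (hx.differentiableAt (by simp)).hasFDerivAt
    have h2 : HasFDerivAt H (c • (fderiv ℝ ρ (A x)).comp TR) x :=
      (h1.comp x (hAd x)).const_mul c
    rw [h2.fderiv]
    simp [hTRa]
  have hHd0 : ∀ x, fderiv ℝ H 0 x = x.2.im := by
    intro x
    rw [hHd.self_of_nhds x, hA0, hT]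
  have hhess : ∀ a b, hess H 0 a b = c * hess ρ p (T a) (T b) := by
    intro a b
    have h1 := hasFDerivAt_fderiv_apply hHs.self_of_nhds b
    have h2 : HasFDerivAt (fun q => fderiv ℝ ρ q (T b)) ((hess ρ p).flip (T b)) (A 0) := by
      rw [hA0]
      exact hasFDerivAt_fderiv_apply hρs.self_of_nhds (T b)
    have h3 := (h2.comp 0 (hAd 0)).const_mul c
    have h4 := h3.congr_of_eventuallyEq (f₁ := fun x => fderiv ℝ H x b)
      (hHd.mono fun x hx => hx b)
    have h5 := congrArg (fun L => L a) (h1.unique h4)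
    simpa [hTRa] using h5
  have htay := taylor_isBigO (d := 2) (f := H)
    (hHs.self_of_nhds.of_le (WithTop.coe_le_coe.2 le_top))
  have htay' : (fun x => H x - (x.2.im + 1 / 2 * hess H 0 x x)) =O[𝓝 0] fun x => ‖x‖ ^ 3 := by
    refine htay.congr_left fun x => ?_
    rw [Finset.sum_range_succ, Finset.sum_range_succ, Finset.sum_range_one, iteratedFDeriv_two_apply]
    simp [hH0, hHd0, hess]
  set N : Yn n → ℝ := fun y => -(c / 2) * hess ρ p (T (lift y 0)) (T (lift y 0)) with hN
  have hN' : ∀ y, N y = -(1 / 2) * hess H 0 (lift y 0) (lift y 0) := by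
    intro y
    simp only [hhess, hN]
    ring
  have hl0 : (fun y => lift y 0) =O[𝓝 0] fun y : Yn n => ‖y‖ := lift_isBigO (isBigO_zero _ _)
  have hbil : ∀ {f g : Yn n → Cn1 n} {a b : ℕ}, f =O[𝓝 0] (fun y => ‖y‖ ^ a) →
      g =O[𝓝 0] (fun y => ‖y‖ ^ b) →
      (fun y => hess H 0 (f y) (g y)) =O[𝓝 0] fun y => ‖y‖ ^ (a + b) := by
    intro f g a b hf hg
    have h1 : (fun y => hess H 0 (f y) (g y)) =O[𝓝 0] fun y => ‖f y‖ * ‖g y‖ := by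
      refine IsBigO.of_bound ‖hess H 0‖ (Eventually.of_forall fun y => ?_)
      rw [norm_mul, norm_norm, norm_norm, ← mul_assoc]
      exact (hess H 0).le_opNorm₂ _ _
    refine h1.trans ((hf.norm_left.mul hg.norm_left).congr_right fun y => ?_)
    rw [pow_add]
  have hl1 : (fun y => lift y 0) =O[𝓝 0] fun y : Yn n => ‖y‖ ^ 1 := by simpa using hl0
  have hNO : N =O[𝓝 0] fun y => ‖y‖ ^ 2 := by
    refine ((hbil hl1 hl1).const_mul_left (-(1 / 2))).congr_left fun y => (hN' y).symm
  have hlN := lift_isBigO hNO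
  have hlN1 : (fun y => lift y (N y)) =O[𝓝 0] fun y : Yn n => ‖y‖ ^ 1 := by simpa using hlN
  have hdiff : (fun y => lift y (N y) - lift y 0) =O[𝓝 0] fun y : Yn n => ‖y‖ ^ 2 := by
    refine IsBigO.trans (IsBigO.of_bound 1 (Eventually.of_forall fun y => ?_)) hNO
    rw [norm_lift_sub_lift, sub_zero, one_mul, Real.norm_eq_abs]
  have hK : (fun y => H (lift y (N y))) =O[𝓝 0] fun y => ‖y‖ ^ 3 := by
    have h1 := (htay'.comp_tendsto (tendsto_zero_of_isBigO_pow one_ne_zero hlN1)).trans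
      (hlN.norm_left.pow 3)
    have h2a := hbil hlN1 hdiff
    have h2b := hbil hdiff hl1
    have h2 := (h2a.add h2b).const_mul_left (1 / 2)
    refine (h1.add h2).congr_left fun y => ?_
    have h3 : (lift y (N y)).2.im = -(1 / 2) * hess H 0 (lift y 0) (lift y 0) := hN' y
    simp only [Function.comp_apply, h3, map_sub, sub_apply]
    ring
  obtain ⟨φ, hs, h0, hO, hiff⟩ := exists_graph hHs hH0 hHd0
    (tendsto_zero_of_isBigO_pow two_ne_zero hNO) hK
  refine ⟨φ, ⟨hAc, hA0, ?_, hs, h0, ?_⟩, hO⟩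
  · exact T.hasFDerivAt.const_add p
  · filter_upwards [hAt.eventually hρ.eventually_mem_iff, hiff] with x hx1 hx2
    rw [hx1, ← hx2, hH]
    simp [hc]

theorem exists_quadratic_chart {ℓ : ℕ} {ρ : Cn1 n → ℝ} (hp : p ∈ M) (hρ : IsLocalDefining M p ρ)
    (T : Cn1 n ≃L[ℂ] Cn1 n) {c : ℝ} (hc : c ≠ 0) (hT : ∀ x, c * fderiv ℝ ρ p (T x) = x.2.im)
    (hlevi : ∀ z, c * (hess ρ p (T (z, 0)) (T (z, 0)) +
      hess ρ p (T (Complex.I • z, 0)) (T (Complex.I • z, 0))) = -4 * (normSqL ℓ z).re) :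
    ∃ Γ φ, IsGraphChart M p T Γ φ ∧
      (fun y => φ y - qf ℓ y.1) =O[𝓝 0] fun y => ‖y‖ ^ 3 := by
  obtain ⟨φ, hφ, hO⟩ := exists_affine_chart hp hρ T hc hT
  set Q : Yn n → ℝ := fun y => -(c / 2) * hess ρ p (T (lift y 0)) (T (lift y 0)) with hQ
  have hl : ∀ (t : ℝ) (y : Yn n), lift (t • y) 0 = t • lift y 0 := by
    intro t y
    refine Prod.ext rfl ?_
    apply Complex.ext <;> simp [lift]
  have hTs : ∀ (t : ℝ) (x : Cn1 n), T (t • x) = t • T x := fun t x =>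
    ((T : Cn1 n →L[ℂ] Cn1 n).restrictScalars ℝ).map_smul t x
  have hQh : ∀ (t : ℝ) y, Q (t • y) = t ^ 2 * Q y := by
    intro t y
    simp only [hQ, hl, hTs, map_smul, smul_apply, smul_eq_mul]
    ring
  have hqh : ∀ (t : ℝ) (y : Yn n), qf ℓ (t • y).1 = t ^ 2 * qf ℓ y.1 := by
    intro t y
    have h1 := qf_smul ℓ (t : ℂ) y.1
    rw [Complex.ofReal_re, Complex.ofReal_im, zero_pow two_ne_zero, add_zero] at h1
    rw [← h1]
    congr 1
  have hQO : Q =O[𝓝 0] fun y => ‖y‖ ^ 2 := by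
    have hl0 : (fun y => lift y 0) =O[𝓝 0] fun y : Yn n => ‖y‖ := lift_isBigO (isBigO_zero _ _)
    have h1 : (fun y => T (lift y 0)) =O[𝓝 0] fun y : Yn n => ‖y‖ :=
      ((T : Cn1 n →L[ℂ] Cn1 n).isBigO_comp _ _).trans hl0
    have h2 : (fun y => hess ρ p (T (lift y 0)) (T (lift y 0))) =O[𝓝 0]
        fun y => ‖T (lift y 0)‖ * ‖T (lift y 0)‖ := by
      refine IsBigO.of_bound ‖hess ρ p‖ (Eventually.of_forall fun y => ?_)
      rw [norm_mul, norm_norm, ← mul_assoc]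
      exact (hess ρ p).le_opNorm₂ _ _
    refine (h2.trans ((h1.norm_left.mul h1.norm_left).congr_right fun y => ?_)).const_mul_left _
    rw [sq]
  have hφ2 : (fun y => φ y - qf ℓ y.1) =O[𝓝 0] fun y => ‖y‖ ^ 2 := by
    refine (((hO.trans (isBigO_pow_of_le (by norm_num : 2 ≤ 3))).add hQO).sub
      (qf_isBigO ℓ)).congr_left fun y => by ring
  obtain ⟨m, hm⟩ := hφ.exists_leading ℓ hφ2
  -- Two homogeneous quadratic functions that agree up to `O(3)` are equal.
  have hmQ : ∀ y, (m fun _ => y) = Q y - qf ℓ y.1 := by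
    intro y
    rw [← sub_eq_zero]
    refine eq_zero_of_homogeneous_of_isBigO (k := 2)
      (T := fun y => (m fun _ => y) - (Q y - qf ℓ y.1)) (fun t y => ?_) ?_ y
    · have h1 : (m fun _ => t • y) = t ^ 2 • m fun _ => y := by
        simpa using m.map_smul_univ (fun _ => t) (fun _ => y)
      rw [h1, hQh, hqh]
      simp only [smul_eq_mul]
      ring
    · refine (hO.sub hm).congr_left fun y => ?_
      ring
  -- The Levi normalization says `Q(z) + Q(iz) = 2|z|_ℓ²` at `u = 0`, which is exactly the vanishing
  -- of the Hermitian part of `m = Q - |z|_ℓ²`.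
  refine hφ.step_two ℓ m hm fun z => ?_
  have hqI : qf ℓ (Complex.I • z) = qf ℓ z := by
    have h1 := qf_smul ℓ Complex.I z
    rw [Complex.I_re, Complex.I_im, zero_pow two_ne_zero, one_pow, zero_add, one_mul] at h1
    exact h1
  have e1 := hlevi z
  have hz0 : ∀ z : Fin n → ℂ, lift ((z, 0) : Yn n) 0 = (z, 0) := fun z => rfl
  rw [hmQ, hmQ]
  simp only [hQ, hz0, hqI]
  change c * _ = -4 * qf ℓ z at e1
  linarith

theorem exists_normal_chart {ℓ : ℕ} {ρ : Cn1 n → ℝ} (hp : p ∈ M) (hρ : IsLocalDefining M p ρ)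
    (T : Cn1 n ≃L[ℂ] Cn1 n) {c : ℝ} (hc : c ≠ 0) (hT : ∀ x, c * fderiv ℝ ρ p (T x) = x.2.im)
    (hlevi : ∀ z, c * (hess ρ p (T (z, 0)) (T (z, 0)) +
      hess ρ p (T (Complex.I • z, 0)) (T (Complex.I • z, 0))) = -4 * (normSqL ℓ z).re) :
    ∃ Γ φ s, IsGraphChart M p T Γ φ ∧ IsChernMoserTensor ℓ s ∧
      (fun y => φ y - (qf ℓ y.1 - 1 / 4 * (quartic s y.1).re)) =O[𝓝 0] fun y => ‖y‖ ^ 5 := by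
  obtain ⟨Γ₂, φ₂, h₂, hO₂⟩ := exists_quadratic_chart hp hρ T hc hT hlevi
  obtain ⟨Γ₃, φ₃, h₃, hO₃⟩ := h₂.step_three ℓ hO₂
  exact h₃.step_four ℓ hO₃

/-- The local inverse of a holomorphic chart. -/
theorem exists_local_inverse {Γ : Cn1 n → Cn1 n} (hΓ : ContDiff ℂ ∞ Γ) {T : Cn1 n ≃L[ℂ] Cn1 n}
    (hT : HasFDerivAt Γ (T : Cn1 n →L[ℂ] Cn1 n) 0) :
    ∃ F : OpenPartialHomeomorph (Cn1 n) (Cn1 n), Γ 0 ∈ F.source ∧ F (Γ 0) = 0 ∧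
      (F.symm : Cn1 n → Cn1 n) = Γ ∧ DifferentiableOn ℂ F F.source := by
  have hΓ0 : ContDiffAt ℂ 1 Γ 0 := hΓ.contDiffAt.of_le (by simp)
  set e := hΓ0.toOpenPartialHomeomorph Γ hT one_ne_zero with he
  have h0 : (0 : Cn1 n) ∈ e.source := hΓ0.mem_toOpenPartialHomeomorph_source hT one_ne_zero
  have hcoe : (e : Cn1 n → Cn1 n) = Γ := rfl
  have hs0 : e.symm (Γ 0) = 0 := e.left_inv h0
  have hd : ∀ᶠ x in 𝓝 (Γ 0), DifferentiableAt ℂ e.symm x := by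
    have h1 : ContDiffAt ℂ 1 e.symm (Γ 0) := hΓ0.to_localInverse hT one_ne_zero
    exact (h1.eventually (by simp)).mono fun x hx => hx.differentiableAt one_ne_zero
  -- The inverse is known to be holomorphic only near `Γ 0`, so its domain is cut down to such a
  -- neighborhood.
  obtain ⟨U, hU, hUo, hU0⟩ := eventually_nhds_iff.1 hd
  refine ⟨e.symm.restrOpen U hUo, ?_, hs0, rfl, ?_⟩
  · exact ⟨e.map_source h0, hU0⟩
  · intro x hx
    exact (hU x hx.2).differentiableWithinAt

theorem isLittleO_pow_of_isBigO_succ {E F : Type*} [NormedAddCommGroup E] [NormedAddCommGroup F]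
    {f : E → F} {k : ℕ} (hf : f =O[𝓝 0] fun y => ‖y‖ ^ (k + 1)) :
    f =o[𝓝 0] fun y => ‖y‖ ^ k :=
  hf.trans_isLittleO ((isLittleO_pow_pow (𝕜 := ℝ) (Nat.lt_succ_self k)).comp_tendsto
    tendsto_norm_zero)

/-- For `|t| < 1` the point `(tz, t²u)` has norm at most `|t|` times a bound for the compact set, so
unweighted order `k + 1` leaves a spare factor `|t|`. -/
theorem isLittleOWt_of_isBigO {R : Yn n → ℝ} {k : ℕ}
    (hR : R =O[𝓝 0] fun y => ‖y‖ ^ (k + 1)) : IsLittleOWt k R := by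
  intro K hK
  obtain ⟨C, hC⟩ := hR.bound
  obtain ⟨ε, hε, hball⟩ := Metric.eventually_nhds_iff_ball.1 hC
  obtain ⟨B, hB⟩ := hK.isBounded.exists_norm_le
  set B' := |B| + 1 with hB'
  have hB'pos : 0 < B' := by positivity
  have hKB : ∀ y ∈ K, ‖y‖ ≤ B' := fun y hy => (hB y hy).trans (by
    rw [hB']; linarith [le_abs_self B])
  rw [Metric.tendstoUniformlyOn_iff]
  intro η hη
  have h1 : ∀ᶠ t : ℝ in 𝓝 0, |t| < 1 ∧ |t| * B' < ε ∧ |C| * B' ^ (k + 1) * |t| < η := by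
    have c1 : Tendsto (fun t : ℝ => |t|) (𝓝 0) (𝓝 0) := by simpa using continuous_abs.tendsto (0 : ℝ)
    have c2 : Tendsto (fun t : ℝ => |t| * B') (𝓝 0) (𝓝 0) := by simpa using c1.mul_const B'
    have c3 : Tendsto (fun t : ℝ => |C| * B' ^ (k + 1) * |t|) (𝓝 0) (𝓝 0) := by
      simpa using c1.const_mul (|C| * B' ^ (k + 1))
    exact (c1.eventually (gt_mem_nhds one_pos)).and
      ((c2.eventually (gt_mem_nhds hε)).and (c3.eventually (gt_mem_nhds hη)))
  filter_upwards [h1.filter_mono nhdsWithin_le_nhds, self_mem_nhdsWithin] with t ht ht0 y hy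
  obtain ⟨ht1, ht2, ht3⟩ := ht
  have ht0 : 0 < |t| := abs_pos.2 ht0
  have hn : ‖((t • y.1, t ^ 2 * y.2) : Yn n)‖ ≤ |t| * B' := by
    rw [Prod.norm_mk]
    refine max_le ?_ ?_
    · rw [norm_smul, Real.norm_eq_abs]
      gcongr
      exact (norm_fst_le y).trans (hKB y hy)
    · rw [norm_mul, norm_pow, Real.norm_eq_abs]
      have h2 : ‖y.2‖ ≤ B' := (norm_snd_le y).trans (hKB y hy)
      have h3 : |t| ^ 2 ≤ |t| := by nlinarith
      exact mul_le_mul h3 h2 (norm_nonneg _) ht0.le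
  have hb := hball (t • y.1, t ^ 2 * y.2) (mem_ball_zero_iff.2 (hn.trans_lt ht2))
  rw [norm_pow, norm_norm] at hb
  rw [dist_zero_left, norm_div, norm_pow, Real.norm_eq_abs t, div_lt_iff₀ (pow_pos ht0 k)]
  calc ‖R (t • y.1, t ^ 2 * y.2)‖ ≤ C * ‖((t • y.1, t ^ 2 * y.2) : Yn n)‖ ^ (k + 1) := hb
    _ ≤ |C| * (|t| * B') ^ (k + 1) := by
      gcongr
      exact le_abs_self C
    _ = (|C| * B' ^ (k + 1) * |t|) * |t| ^ k := by ring
    _ < η * |t| ^ k := mul_lt_mul_of_pos_right ht3 (pow_pos ht0 k)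

theorem contDiff_quartic_re (s : Fin n → Fin n → Fin n → Fin n → ℂ) :
    ContDiff ℝ ∞ (fun y : Yn n => (quartic s y.1).re) := by
  have hc : ∀ j, ContDiff ℝ ∞ (fun y : Yn n => conj (y.1 j)) := fun j =>
    Complex.conjCLE.contDiff.comp (by fun_prop)
  have hz : ∀ j, ContDiff ℝ ∞ (fun y : Yn n => y.1 j) := fun j => by fun_prop
  unfold quartic
  refine Complex.reCLM.contDiff.comp (ContDiff.sum fun α _ => ContDiff.sum fun β _ =>
    ContDiff.sum fun γ _ => ContDiff.sum fun δ _ => ?_)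
  exact contDiff_const.mul ((((hz α).mul (hc β)).mul (hz γ)).mul (hc δ))

end Final

end CRHyp

end

/-! ### The proposition. -/

open CRHyp
theorem proposition2p1 (n ℓ : ℕ) (hn : 2 ≤ n) (hℓ : 2 * ℓ ≤ n)
    (M : Set (Cn1 n)) (hM : IsSmoothHypersurface M) (hL : IsLeviNondegenerate M ℓ)
    (p : Cn1 n) (hp : p ∈ M)
    (θ : tangentSpaceAt M p →ₗ[ℝ] ℝ) (hθ : IsAppropriateContactForm M ℓ p θ) :
    ∃ (F : OpenPartialHomeomorph (Cn1 n) (Cn1 n))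
      (s : Fin n → Fin n → Fin n → Fin n → ℂ) (R : (Fin n → ℂ) × ℝ → ℝ),
      p ∈ F.source ∧ F p = 0 ∧
      DifferentiableOn ℂ F F.source ∧ DifferentiableOn ℂ F.symm F.target ∧
      (∀ᶠ x in 𝓝 (0 : Cn1 n), x ∈ F '' (M ∩ F.source) ↔ normalForm ℓ s R x = 0) ∧
      IsChernMoserTensor ℓ s ∧
      (∀ z, laplacianL ℓ (quartic s) z = 0) ∧
      (∃ V ∈ 𝓝 (0 : (Fin n → ℂ) × ℝ), ContDiffOn ℝ ∞ R V) ∧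
      IsLittleOWt 4 R ∧
      R =o[𝓝 0] (fun y => ‖y‖ ^ 4) ∧
      (∀ y ∈ tangentSpaceAt (F '' (M ∩ F.source)) 0,
        ∃ hy : fderiv ℝ F.symm 0 y ∈ tangentSpaceAt M p,
          Complex.I * del (normalForm ℓ s R) 0 y = (θ ⟨fderiv ℝ F.symm 0 y, hy⟩ : ℂ)) := by
  obtain ⟨ρ, hρ⟩ := hM p hp
  obtain ⟨T, c, hc, hT, hlevi, hθT⟩ := exists_adapted_frame (by omega) hp hρ hθ
  obtain ⟨Γ, φ, s, hΓ, hs, hO⟩ := exists_normal_chart hp hρ T hc hT hlevi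
  obtain ⟨F, hF1, hF2, hF3, hF4⟩ := exists_local_inverse hΓ.contDiff hΓ.hasFDerivAt
  rw [hΓ.apply_zero] at hF1 hF2
  -- This choice makes `r` equal to `v - φ(z, u)` identically.
  set R : Yn n → ℝ := fun y => qf ℓ y.1 - 1 / 4 * (quartic s y.1).re - φ y with hR
  have hRO : R =O[𝓝 0] fun y => ‖y‖ ^ (4 + 1) := hO.neg_left.congr_left fun y => by
    simp only [hR]; ring
  have hnf : ∀ x, normalForm ℓ s R x = ((x.2.im - φ (x.1, x.2.re) : ℝ) : ℂ) := by
    intro x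
    rw [normalForm, ← normSqL_eq_re, ← quartic_eq_re hs, hR]
    simp only [qf]
    push_cast
    ring
  have hmem : ∀ᶠ x in 𝓝 (0 : Cn1 n), (x ∈ F '' (M ∩ F.source) ↔ x.2.im - φ (x.1, x.2.re) = 0) := by
    have h0 : (0 : Cn1 n) ∈ F.target := hF2 ▸ F.map_source hF1
    filter_upwards [hΓ.mem_iff, F.open_target.mem_nhds h0] with x hx hxt
    rw [sub_eq_zero, ← hx, ← hF3]
    constructor
    · rintro ⟨q, ⟨hqM, hqs⟩, rfl⟩
      rwa [F.left_inv hqs]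
    · intro h
      exact ⟨F.symm x, ⟨h, F.map_target hxt⟩, F.right_inv hxt⟩
  set r : Cn1 n → ℝ := fun x => x.2.im - φ (x.1, x.2.re) with hr
  let A : Cn1 n →L[ℝ] Yn n := (ContinuousLinearMap.fst ℝ _ _).comp (unliftL n)
  let B : Cn1 n →L[ℝ] ℝ := (ContinuousLinearMap.snd ℝ _ _).comp (unliftL n)
  have hAt : Filter.Tendsto A (𝓝 0) (𝓝 0) := by simpa using A.continuous.tendsto 0
  have hrd : HasFDerivAt r B 0 := by
    have hφ2 : φ =O[𝓝 0] fun y => ‖y‖ ^ 2 := by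
      refine (((hO.trans (isBigO_pow_of_le (by norm_num : 2 ≤ 5))).add (qf_isBigO ℓ)).sub
        (((isBigO_re (quartic_isBigO s)).trans
          (isBigO_pow_of_le (by norm_num : 2 ≤ 4))).const_mul_left (1 / 4))).congr_left fun y => ?_
      ring
    have h1 : HasFDerivAt φ (0 : Yn n →L[ℝ] ℝ) (A 0) := by
      rw [map_zero]
      exact hasFDerivAt_zero_of_isBigO hφ2
    have h2 := B.hasFDerivAt (x := 0) |>.sub (h1.comp 0 A.hasFDerivAt)
    refine h2.congr_fderiv ?_
    simp
  have hrs : ∀ᶠ x in 𝓝 0, ContDiffAt ℝ ∞ r x := by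
    filter_upwards [hAt.eventually hΓ.smooth] with x hx
    exact B.contDiff.contDiffAt.sub (hx.comp x A.contDiff.contDiffAt)
  have hBne : B ≠ 0 := by
    intro h
    have := congrArg (fun L => L ((0, Complex.I) : Cn1 n)) h
    simp [B, unliftL_apply] at this
  have hloc : IsLocalDefining (F '' (M ∩ F.source)) 0 r :=
    .of_eventually hrs (by rw [hrd.fderiv]; exact hBne) hmem
  refine ⟨F, s, R, hF1, hF2, hF4, ?_, ?_, hs, laplacianL_quartic hs, ?_,
    isLittleOWt_of_isBigO hRO, isLittleO_pow_of_isBigO_succ hRO, ?_⟩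
  · rw [hF3]
    exact (hΓ.contDiff.differentiable (by simp)).differentiableOn
  · filter_upwards [hmem] with x hx
    rw [hx, hnf, Complex.ofReal_eq_zero]
  · refine ⟨_, hΓ.smooth, fun y hy => ?_⟩
    exact (((contDiff_qf ℓ).contDiffAt.sub
      (contDiffAt_const.mul (contDiff_quartic_re s).contDiffAt)).sub hy).contDiffWithinAt
  · intro y hy
    have h0mem : (0 : Cn1 n) ∈ F '' (M ∩ F.source) := ⟨p, ⟨hp, hF1⟩, hF2⟩
    have hyim : y.2.im = 0 := by
      have := (hloc.mem_tangentSpaceAt h0mem).1 hy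
      rw [hrd.fderiv] at this
      exact this
    have hfd : fderiv ℝ F.symm 0 y = T y := by
      rw [hF3, (hΓ.hasFDerivAt.restrictScalars ℝ).fderiv]
      rfl
    have hTy : T y ∈ tangentSpaceAt M p := by
      rw [hρ.mem_tangentSpaceAt hp]
      have := hT y
      rw [hyim] at this
      exact (mul_eq_zero.1 this).resolve_left hc
    refine ⟨hfd ▸ hTy, ?_⟩
    have hθy : θ ⟨fderiv ℝ F.symm 0 y, hfd ▸ hTy⟩ = y.2.re / 2 := by
      rw [← hθT y hTy]
      congr 2
    have hnfd : HasFDerivAt (normalForm ℓ s R) (Complex.ofRealCLM.comp B) 0 := by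
      have h1 : normalForm ℓ s R = fun x => Complex.ofRealCLM (r x) := funext hnf
      rw [h1]
      exact Complex.ofRealCLM.hasFDerivAt.comp 0 hrd
    have hB : ∀ x, B x = x.2.im := fun x => rfl
    -- At `0` the differential of `r` is `dv`, so `i∂r = dw/2`, which on a tangent vector, where `v
    -- = 0`, is `u/2`.
    rw [hθy, del, hnfd.fderiv]
    simp only [ContinuousLinearMap.comp_apply, hB, hyim, Complex.ofRealCLM_apply]
    have hI : (Complex.I • y).2.im = y.2.re := by simp
    rw [hI]
    push_cast
    linear_combination (-(1 / 2) * (y.2.re : ℂ)) * Complex.I_mul_I
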